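/- **Setting.** Let $n\ge 1$, $m>0$, and let $\mu$ be a measure on $\mathbb R^n$ with $\mu(B(x,r))\lesssim r^m$ for all $x\in\mathbb R^n$, $r>0$. Let $T:L^2(\mu)\to L^2(\mu)$ be a bounded Calderón–Zygmund operator: $T$ is linear and bounded, and there are $C,\alpha>0$ and a kernel $K$ with $|K(x,y)|\le C|x-y|^{-m}$ for $x\neq y$, $|K(x,y)-K(x',y)|\le C\frac{|x-x'|^\alpha}{|x-y|^{m+\alpha}}$ if $|x-y|\ge 2|x-x'|$, $|K(x,y)-K(x,y')|\le C\frac{|y-y'|^\alpha}{|x-y|^{m+\alpha}}$ if $|x-y|\ge 2|y-y'|$ (always for $x\ne y$), and $Tf(x)=\int K(x,y)f(y)\,d\mu(y)$ for $f\in L^2(\mu)$ and $\mu$-a.e. $x\notin\operatorname{spt}f$. Cubes are half-open and axis-parallel; $\ell(Q)$ is the side length of $Q$, $\mathrm{ch}(Q)$ the set of its $2^n$ dyadic children, and $\langle f\rangle_Q=\mu(Q)^{-1}\int_Q f\,d\mu$ (read as $0$ if $\mu(Q)=0$). For every cube $Q\subset\mathbb R^n$ let $b_Q\in L^2(\mu)$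 vanish $\mu$-a.e. outside $Q$ and satisfy $$\int_Q b_Q\,d\mu=\mu(Q),\qquad \|b_Q\|_{L^2(\mu)}^2\le A\,\mu(Q),\qquad \|1_Q\,Tb_Q\|_{L^2(\mu)}^2\le B\,\mu(Q),$$ with constants $A,B$ not depending on $Q$. Let $M_\mu h(x)=\sup_{r>0}\mu(B(x,r))^{-1}\int_{B(x,r)}|h|\,d\mu$ and let $\|M_\mu\|$ be its norm on $L^2(\mu)$. **Stopping cubes.** Fix a cube $Q^*$ and let $\mathcal D$ be the collection of all dyadic descendants of $Q^*$, including $Q^*$. Put $\mathcal F^0=\{Q^*\}$. Given $\mathcal F^j$, let $\mathcal F^{j+1}$ consist, for all $F\in\mathcal F^j$, of the maximal cubes $Q\in\mathcal D$, $Q\subset F$, for which at least one of the following holds: $$|\langle b_F\rangle_Q|<\tfrac12,\qquad \langle |M_\mu b_F|^2\rangle_Q>16A^2\|M_\mu\|^2,\qquad \langle |Tb_F|^2\rangle_Q>16AB .$$ Let $\mathcal F=\bigcup_{j\ge0}\mathcal F^j$. For $Q\in\mathcal D$ let $Q^a$ be the minimal $S\in\mathcal F$ with $Q\subset S$. For $F\in\mathcal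 F^j$ let $\mathcal H_F=\{H\in\mathcal F^{j+1}:H\subset F\}$. For $Q\in\mathcal D$ with $Q^a=F$ the half-twisted martingale difference is $$D_Qh=\sum_{Q'\in \mathrm{ch}(Q)\setminus\mathcal H_F}\left[\frac{\langle h\rangle_{Q'}}{\langle b_{(Q')^a}\rangle_{Q'}}-\frac{\langle h\rangle_Q}{\langle b_F\rangle_Q}\right]1_{Q'} .$$ **Proposition.** Let $F\in\mathcal F$, let $\epsilon_Q$, $Q\in\mathcal D$, be complex constants with $|\epsilon_Q|\le1$, and let $p\in(1,\infty)$. Then for every $h\in L^p(\mu)$ $$\left\|\sup_{\epsilon>0}\Big|\sum_{\substack{Q\in\mathcal D\\ Q^a=F,\ \ell(Q)>\epsilon}}\epsilon_Q D_Qh\Big|\right\|_{L^p(\mu)}^p\le C\,\|h\|_{L^p(\mu)}^p ,$$ where the constant $C$ depends only on $n$, $p$ and $A$. -/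

import Mathlib

open MeasureTheory
open scoped ENNReal NNReal

noncomputable section

namespace LocalTb

/-! ### Cubes and dyadic grids -/

/-- An axis-parallel cube in `ℝⁿ`, given by its lower corner and its side length `ℓ(Q) > 0`. -/
@[ext]
structure Cube (n : ℕ) where
  corner : EuclideanSpace ℝ (Fin n)
  side : ℝ
  side_pos : 0 < side

namespace Cube

variable {n : ℕ}

/-- The point set of a cube. Cubes are half-open, so that the `2ⁿ` dyadic children of a cube
partition it, for an arbitrary measure. -/
def toSet (Q : Cube n) : Set (EuclideanSpace ℝ (Fin n)) :=
  {x | ∀ i, Q.corner i ≤ x i ∧ x i < Q.corner i + Q.side}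

/-- The dyadic child of `Q` with position `σ ∈ {0,1}ⁿ`. -/
def child (Q : Cube n) (σ : Fin n → Fin 2) : Cube n where
  corner := WithLp.toLp 2 fun i => Q.corner i + (σ i : ℕ) * (Q.side / 2)
  side := Q.side / 2
  side_pos := half_pos Q.side_pos

/-- The dyadic descendants of `Q₀` of side length `ℓ(Q₀) / 2 ^ k`. -/
def dyadicGen (Q₀ : Cube n) : ℕ → Set (Cube n)
  | 0 => {Q₀}
  | k + 1 => ⋃ Q ∈ dyadicGen Q₀ k, Set.range (child Q)

/-- The dyadic grid with top cube `Q₀`: all dyadic cubes contained in `Q₀`, including `Q₀`. -/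
def dyadic (Q₀ : Cube n) : Set (Cube n) := ⋃ k, dyadicGen Q₀ k

theorem side_of_mem_dyadicGen (Q₀ : Cube n) (k : ℕ) :
    ∀ Q ∈ dyadicGen Q₀ k, Q.side = Q₀.side / 2 ^ k := by
  induction k with
  | zero =>
    intro Q hQ
    have h : Q = Q₀ := hQ
    simp [h]
  | succ k ih =>
    intro Q hQ
    simp only [dyadicGen, Set.mem_iUnion] at hQ
    obtain ⟨P, hP, σ, rfl⟩ := hQ
    change P.side / 2 = _
    rw [ih P hP, pow_succ, div_div]

theorem finite_dyadicGen (Q₀ : Cube n) (k : ℕ) : (dyadicGen Q₀ k).Finite := by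
  induction k with
  | zero => exact Set.finite_singleton _
  | succ k ih => exact ih.biUnion fun Q _ => Set.finite_range _

/-- Only finitely many cubes of the grid have side length larger than a given `δ > 0`; hence the
truncated sums below are genuine finite sums. -/
theorem finite_dyadic_lt_side (Q₀ : Cube n) {δ : ℝ} (hδ : 0 < δ) :
    {Q | Q ∈ dyadic Q₀ ∧ δ < Q.side}.Finite := by
  obtain ⟨N, hN⟩ := pow_unbounded_of_one_lt (Q₀.side / δ) (one_lt_two (α := ℝ))
  refine ((Set.finite_lt_nat N).biUnion fun k _ => finite_dyadicGen Q₀ k).subset ?_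
  rintro Q ⟨hQ, hlt⟩
  obtain ⟨k, hk⟩ := Set.mem_iUnion.1 hQ
  refine Set.mem_biUnion (x := k) ?_ hk
  by_contra hkN
  have hle : N ≤ k := not_lt.1 hkN
  rw [side_of_mem_dyadicGen Q₀ k Q hk, lt_div_iff₀ (by positivity)] at hlt
  rw [div_lt_iff₀ hδ] at hN
  have h2 : (2 : ℝ) ^ N ≤ 2 ^ k := pow_le_pow_right₀ one_le_two hle
  nlinarith

end Cube

variable {n : ℕ}

/-! ### Measures, the maximal function, Calderón–Zygmund operators -/

/-- The size condition `μ(B(x, r)) ≲ r ^ m`. -/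
def HasGrowth (μ : Measure (EuclideanSpace ℝ (Fin n))) (m : ℝ) : Prop :=
  ∃ C : ℝ, ∀ x, ∀ r : ℝ, 0 < r → μ (Metric.ball x r) ≤ ENNReal.ofReal (C * r ^ m)

/-- The average `⟨h⟩_Q = μ(Q)⁻¹ ∫_Q h dμ` (equal to `0` if `μ(Q) = 0`). -/
def avg (μ : Measure (EuclideanSpace ℝ (Fin n))) (h : EuclideanSpace ℝ (Fin n) → ℂ)
    (Q : Cube n) : ℂ :=
  ⨍ x in Q.toSet, h x ∂μ

/-- The centred maximal function
`M_μ h(x) = sup_{r > 0} μ(B(x, r))⁻¹ ∫_{B(x, r)} |h| dμ`. -/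
def centredMaximal (μ : Measure (EuclideanSpace ℝ (Fin n)))
    (h : EuclideanSpace ℝ (Fin n) → ℂ) (x : EuclideanSpace ℝ (Fin n)) : ℝ≥0∞ :=
  ⨆ (r : ℝ) (_ : 0 < r), ⨍⁻ y in Metric.ball x r, ‖h y‖ₑ ∂μ

/-- The norm `‖M_μ‖` of the centred maximal operator on `L²(μ)`. -/
def centredMaximalNorm (μ : Measure (EuclideanSpace ℝ (Fin n))) : ℝ≥0∞ :=
  sInf {C : ℝ≥0∞ | ∀ h : EuclideanSpace ℝ (Fin n) → ℂ, MemLp h 2 μ →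
    eLpNorm (centredMaximal μ h) 2 μ ≤ C * eLpNorm h 2 μ}

/-- `K` is an `m`-dimensional standard kernel with Hölder exponent `α` and constant `C`
(the values of `K` on the diagonal are irrelevant). -/
structure IsStandardKernel (m α C : ℝ)
    (K : EuclideanSpace ℝ (Fin n) → EuclideanSpace ℝ (Fin n) → ℂ) : Prop where
  size : ∀ x y, x ≠ y → ‖K x y‖ ≤ C / ‖x - y‖ ^ m
  smooth_left : ∀ x x' y, x ≠ y → 2 * ‖x - x'‖ ≤ ‖x - y‖ →
    ‖K x y - K x' y‖ ≤ C * ‖x - x'‖ ^ α / ‖x - y‖ ^ (m + α)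
  smooth_right : ∀ x y y', x ≠ y → 2 * ‖y - y'‖ ≤ ‖x - y‖ →
    ‖K x y - K x y'‖ ≤ C * ‖y - y'‖ ^ α / ‖x - y‖ ^ (m + α)

/-- The support of a function with respect to `μ`: the complement of the largest open set on
which the function vanishes `μ`-almost everywhere. -/
def aeSupport (μ : Measure (EuclideanSpace ℝ (Fin n)))
    (f : EuclideanSpace ℝ (Fin n) → ℂ) : Set (EuclideanSpace ℝ (Fin n)) :=
  {x | ∀ r : ℝ, 0 < r → ¬ ∀ᵐ y ∂μ, y ∈ Metric.ball x r → f y = 0}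

/-- A bounded operator on `L²(μ)` is a Calderón–Zygmund operator if it is given by some standard
kernel off the support of the function it acts on. -/
def IsCalderonZygmund (μ : Measure (EuclideanSpace ℝ (Fin n))) (m : ℝ)
    (T : Lp ℂ 2 μ →L[ℂ] Lp ℂ 2 μ) : Prop :=
  ∃ (C α : ℝ) (K : EuclideanSpace ℝ (Fin n) → EuclideanSpace ℝ (Fin n) → ℂ),
    0 < α ∧ IsStandardKernel m α C K ∧
    ∀ f : Lp ℂ 2 μ, ∀ᵐ x ∂μ, x ∉ aeSupport μ f → T f x = ∫ y, K x y * f y ∂μ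

/-- The family `b` of local `L²` test functions for `T`, one for every cube, with constants `A`
and `B`. The third field is the normalisation `⟨b_Q⟩_Q = 1`, written so that it also makes sense
for cubes of measure zero. -/
structure IsTestSystem (μ : Measure (EuclideanSpace ℝ (Fin n)))
    (T : Lp ℂ 2 μ →L[ℂ] Lp ℂ 2 μ) (b : Cube n → Lp ℂ 2 μ) (A B : ℝ) : Prop where
  supp : ∀ Q, ∀ᵐ x ∂μ, x ∉ Q.toSet → b Q x = 0
  integral_eq : ∀ Q, ∫ x in Q.toSet, b Q x ∂μ = (μ.real Q.toSet : ℂ)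
  norm_le : ∀ Q, ‖b Q‖ ^ 2 ≤ A * μ.real Q.toSet
  testing : ∀ Q, ∫ x in Q.toSet, ‖T (b Q) x‖ ^ 2 ∂μ ≤ B * μ.real Q.toSet

/-! ### Stopping cubes -/

section Stopping

variable (μ : Measure (EuclideanSpace ℝ (Fin n))) (T : Lp ℂ 2 μ →L[ℂ] Lp ℂ 2 μ)
  (b : Cube n → Lp ℂ 2 μ) (A B : ℝ) (Qstar : Cube n)

/-- At least one of the three stopping conditions for `b_F` holds on `Q`. -/
def StopCondition (F Q : Cube n) : Prop :=
  ‖avg μ (b F) Q‖ < 1 / 2 ∨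
  ENNReal.ofReal (16 * A ^ 2) * centredMaximalNorm μ ^ 2 <
    ⨍⁻ x in Q.toSet, centredMaximal μ (b F) x ^ 2 ∂μ ∨
  16 * A * B < ⨍ x in Q.toSet, ‖T (b F) x‖ ^ 2 ∂μ

/-- The maximal cubes `Q ⊆ F` of the grid that satisfy the stopping condition for `b_F`. -/
def stopChildren (F : Cube n) : Set (Cube n) :=
  {Q | Q ∈ Qstar.dyadic ∧ Q.toSet ⊆ F.toSet ∧ StopCondition μ T b A B F Q ∧
    ∀ P ∈ Qstar.dyadic, P.toSet ⊆ F.toSet → StopCondition μ T b A B F P →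
      Q.toSet ⊆ P.toSet → P = Q}

/-- The `j`-th generation of stopping cubes. -/
def stopGen : ℕ → Set (Cube n)
  | 0 => {Qstar}
  | j + 1 => ⋃ F ∈ stopGen j, stopChildren μ T b A B Qstar F

/-- The collection of all stopping cubes. -/
def stopCubes : Set (Cube n) := ⋃ j, stopGen μ T b A B Qstar j

open Classical in
/-- `Q^a`: the minimal stopping cube containing `Q`. For `Q` in the grid it exists, because the
stopping cubes containing `Q` form a finite chain that contains the top cube. -/
def stopParent (Q : Cube n) : Cube n :=
  if h : ∃ S ∈ stopCubes μ T b A B Qstar, Q.toSet ⊆ S.toSet ∧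
      ∀ S' ∈ stopCubes μ T b A B Qstar, Q.toSet ⊆ S'.toSet → S.toSet ⊆ S'.toSet
  then h.choose else Qstar

/-- For a stopping cube `F` of generation `j`, the stopping cubes of generation `j + 1` inside
`F`. -/
def stopNext (j : ℕ) (F : Cube n) : Set (Cube n) :=
  {H | H ∈ stopGen μ T b A B Qstar (j + 1) ∧ H.toSet ⊆ F.toSet}

open Classical in
/-- The half-twisted martingale difference, for a stopping cube `F` of generation `j`:
`D_Q h = ∑_{Q' ∈ ch(Q), Q' ∉ 𝓗_F} (⟨h⟩_{Q'} / ⟨b_{(Q')^a}⟩_{Q'} - ⟨h⟩_Q / ⟨b_F⟩_Q) 1_{Q'}`. -/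
def halfTwisted (j : ℕ) (F : Cube n) (h : EuclideanSpace ℝ (Fin n) → ℂ) (Q : Cube n)
    (x : EuclideanSpace ℝ (Fin n)) : ℂ :=
  ∑ σ : Fin n → Fin 2 with Q.child σ ∉ stopNext μ T b A B Qstar j F,
    (Q.child σ).toSet.indicator
      (fun _ => avg μ h (Q.child σ) /
          avg μ (b (stopParent μ T b A B Qstar (Q.child σ))) (Q.child σ)
        - avg μ h Q / avg μ (b F) Q) x

/-- The maximal truncation
`sup_{δ > 0} |∑_{Q in the grid, Q^a = F, ℓ(Q) > δ} ε_Q D_Q h|`. -/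
def maximalTruncation (j : ℕ) (F : Cube n) (ε : Cube n → ℂ)
    (h : EuclideanSpace ℝ (Fin n) → ℂ) (x : EuclideanSpace ℝ (Fin n)) : ℝ≥0∞ :=
  ⨆ (δ : ℝ) (_ : 0 < δ),
    ‖∑ᶠ Q ∈ {Q | Q ∈ Qstar.dyadic ∧ stopParent μ T b A B Qstar Q = F ∧ δ < Q.side},
      ε Q * halfTwisted μ T b A B Qstar j F h Q x‖ₑ

end Stopping

end LocalTb

end

namespace LocalTb

/-! ### Averages over nested finite partitions -/

section Partition

variable {X I : Type}

/-! Fix `F`, let E_k be averaging over the generation-`k` descendants of `F`, and let α_k be the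
union of those among them whose stopping parent is `F`. If μ(F) > 0, then a child outside 𝓗_F of a
cube with parent `F` again has parent `F`. So D_Q h is the increment E_{k+1}h / E_{k+1}b_F - E_k h /
E_k b_F cut off to α_{k+1} (`mul_halfTwisted_eq_quotIncrement`), and at a fixed point the
truncations are the partial sums over k. On α_k no stopping condition holds: |E_k b_F| ≥ 1/2, and
E_k|b_F| ≤ L = 1 + 16A²K², because |b_F| ≤ M_μ b_F almost everywhere and ‖M_μ‖ ≤ K with K depending
only on the dimension, by Besicovitch (`isAccretiveOn_activeSet`). What remains is a statement about
nested finite partitions.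

Without doubling, the averages on a cell that has just left α_k may be arbitrarily large, and the
cut-off destroys the martingale property. The remedy is that a predictable coefficient times a
martingale difference has integral zero over α_k. Its integral over α_{k+1} is thus minus the one
over the cells that leave, which is at most a multiple of their mass ∫|f| + Λμ; these masses
telescope in k (`norm_setIntegral_mul_diff_le`). The same device bounds the energy of a martingale
stopped before its averages get large (`sum_setIntegral_normSq_diff_le`). Expanding |S|² to second
order along an increment of the quotient leaves linear terms with predictable coefficients and
squares of martingale differences. If the averages of |h| are at most l and the sums are frozen
above t, this bounds their second moment by C(tl + l²) times the measure of the starting set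
(`integral_normSq_stoppedSum_le`).

Restarting this estimate where the partial sums first exceed t, with l = γt, gives a good-λ
inequality with gain γ against the martingale maximal function of h (`measureReal_goodLambda_le`).
Together with Doob's inequality this gives every p in (1, ∞) at once. Only finitely many generations
are used until the very end, so every integral that gets absorbed is finite; monotone convergence
then removes the restriction. -/

theorem factorsThrough_indicator {Y : Type} [Zero Y] {c : X → I} {s : Set X}
    (hs : Function.FactorsThrough (· ∈ s) c) {g : X → Y} (hg : g.FactorsThrough c) :
    (s.indicator g).FactorsThrough c := by
  classical
  intro x y h
  have h1 : (x ∈ s) = (y ∈ s) := hs h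
  simp only [Set.indicator, h1, hg h]

variable [MeasurableSpace X]

/-- A finite partition of `X` into measurable cells, the cells being the fibres of `c`. -/
structure IsPartition (c : X → I) : Prop where
  finite : (Set.range c).Finite
  meas : ∀ i, MeasurableSet (c ⁻¹' {i})

/-- A nested sequence of finite measurable partitions. -/
structure IsPartitionSeq (c : ℕ → X → I) : Prop where
  part : ∀ k, IsPartition (c k)
  nested : ∀ k, Function.FactorsThrough (c k) (c (k + 1))

/-- The average of `f` over the cell of the partition `c` that contains `x`. -/
noncomputable def cellAvg {E : Type} [NormedAddCommGroup E] [NormedSpace ℝ E] (μ : Measure X)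
    (c : X → I) (f : X → E) (x : X) : E :=
  ⨍ y in c ⁻¹' {c x}, f y ∂μ

theorem factorsThrough_cellAvg {E : Type} [NormedAddCommGroup E] [NormedSpace ℝ E]
    (μ : Measure X) (c : X → I) (f : X → E) : (cellAvg μ c f).FactorsThrough c := by
  intro x y h
  simp only [cellAvg, h]

theorem IsPartitionSeq.factorsThrough_of_le {c : ℕ → X → I} (hc : IsPartitionSeq c) {j k : ℕ}
    (hjk : j ≤ k) : Function.FactorsThrough (c j) (c k) := by
  induction k, hjk using Nat.le_induction with
  | base => exact fun _ _ h => h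
  | succ k _ ih => exact fun x y h => ih (hc.nested k h)

theorem IsPartitionSeq.mono {Y : Type} {c : ℕ → X → I} (hc : IsPartitionSeq c) {j k : ℕ}
    (hjk : j ≤ k) {g : X → Y} (hg : g.FactorsThrough (c j)) : g.FactorsThrough (c k) :=
  fun _ _ h => hg (hc.factorsThrough_of_le hjk h)

theorem IsPartitionSeq.shift {c : ℕ → X → I} (hc : IsPartitionSeq c) (m : ℕ) :
    IsPartitionSeq fun k => c (m + k) :=
  ⟨fun k => hc.part (m + k), fun k => hc.nested (m + k)⟩

/-! ### Functions constant on the cells of one finite partition -/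

section Level

variable {c : X → I}

theorem IsPartition.finite_range_of_factorsThrough {Y : Type} (hc : IsPartition c) {g : X → Y}
    (hg : g.FactorsThrough c) : (Set.range g).Finite := by
  rcases isEmpty_or_nonempty X with h | ⟨⟨x₀⟩⟩
  · exact Set.toFinite _
  · have : Nonempty Y := ⟨g x₀⟩
    obtain ⟨e, rfl⟩ := (Function.factorsThrough_iff g).1 hg
    rw [Set.range_comp]
    exact hc.finite.image _

/-- Factoring through `c` stands in for measurability with respect to the σ-algebra of the
partition. There are finitely many cells, so every preimage is a finite union of them, whatever the
target. -/
theorem IsPartition.measurableSet_preimage (hc : IsPartition c) {Y : Type} {g : X → Y}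
    (hg : g.FactorsThrough c) (s : Set Y) : MeasurableSet (g ⁻¹' s) := by
  have : g ⁻¹' s = ⋃ i ∈ c '' (g ⁻¹' s), c ⁻¹' {i} := by
    ext x
    simp only [Set.mem_preimage, Set.mem_image, Set.mem_iUnion, Set.mem_singleton_iff, exists_prop]
    constructor
    · exact fun hx => ⟨c x, ⟨x, hx, rfl⟩, rfl⟩
    · rintro ⟨_, ⟨y, hy, rfl⟩, hxy⟩
      rwa [hg hxy]
  rw [this]
  exact (hc.finite.subset (Set.image_subset_range _ _)).measurableSet_biUnion fun i _ => hc.meas i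

theorem IsPartition.measurableSet (hc : IsPartition c) {s : Set X}
    (hs : Function.FactorsThrough (· ∈ s) c) : MeasurableSet s := by
  simpa using hc.measurableSet_preimage hs {True}

theorem IsPartition.measurable (hc : IsPartition c) {Y : Type} [MeasurableSpace Y] {g : X → Y}
    (hg : g.FactorsThrough c) : Measurable g :=
  fun s _ => hc.measurableSet_preimage hg s

theorem IsPartition.exists_norm_le (hc : IsPartition c) {E : Type} [NormedAddCommGroup E]
    {g : X → E} (hg : g.FactorsThrough c) : ∃ C, ∀ x, ‖g x‖ ≤ C := by
  obtain ⟨C, hC⟩ := (hc.finite_range_of_factorsThrough hg).isBounded.exists_norm_le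
  exact ⟨C, fun x => hC _ ⟨x, rfl⟩⟩

theorem IsPartition.aestronglyMeasurable (hc : IsPartition c) (μ : Measure X) {𝕜 : Type}
    [RCLike 𝕜] {g : X → 𝕜} (hg : g.FactorsThrough c) : AEStronglyMeasurable g μ :=
  (hc.measurable hg).aestronglyMeasurable

theorem IsPartition.integrable (hc : IsPartition c) (μ : Measure X) [IsFiniteMeasure μ] {𝕜 : Type}
    [RCLike 𝕜] {g : X → 𝕜} (hg : g.FactorsThrough c) : Integrable g μ := by
  obtain ⟨C, hC⟩ := hc.exists_norm_le hg
  exact Integrable.of_bound (hc.aestronglyMeasurable μ hg) C (Filter.Eventually.of_forall hC)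

theorem IsPartition.integrable_mul (hc : IsPartition c) {μ : Measure X} {𝕜 : Type}
    [RCLike 𝕜] {g f : X → 𝕜} (hg : g.FactorsThrough c) (hf : Integrable f μ) :
    Integrable (fun x => g x * f x) μ := by
  obtain ⟨C, hC⟩ := hc.exists_norm_le hg
  exact hf.bdd_mul (hc.aestronglyMeasurable μ hg) (Filter.Eventually.of_forall hC)

theorem IsPartition.integral_eq_sum (hc : IsPartition c) {μ : Measure X} {𝕜 : Type}
    [RCLike 𝕜] {f : X → 𝕜} (hf : Integrable f μ) :
    ∫ x, f x ∂μ = ∑ i ∈ hc.finite.toFinset, ∫ x in c ⁻¹' {i}, f x ∂μ := by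
  have hU : (Set.univ : Set X) = ⋃ i ∈ hc.finite.toFinset, c ⁻¹' {i} := by
    ext x; simp
  rw [← setIntegral_univ, hU]
  refine integral_biUnion_finset _ (fun i _ => hc.meas i) ?_ fun i _ => hf.integrableOn
  intro i _ j _ hij
  exact Disjoint.preimage c (by simpa using hij)

/-- Averaging over cells is self-adjoint against functions that are constant on cells. -/
theorem IsPartition.integral_mul_cellAvg (hc : IsPartition c) {μ : Measure X} [IsFiniteMeasure μ]
    {𝕜 : Type} [RCLike 𝕜] {g f : X → 𝕜} (hg : g.FactorsThrough c) (hf : Integrable f μ) :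
    ∫ x, g x * cellAvg μ c f x ∂μ = ∫ x, g x * f x ∂μ := by
  rw [hc.integral_eq_sum (hc.integrable_mul hg hf), hc.integral_eq_sum
    (hc.integrable_mul hg (hc.integrable μ (factorsThrough_cellAvg μ c f)))]
  refine Finset.sum_congr rfl fun i hi => ?_
  obtain ⟨x, rfl⟩ : i ∈ Set.range c := by simpa using hi
  have h1 : ∫ y in c ⁻¹' {c x}, g y * cellAvg μ c f y ∂μ
      = ∫ y in c ⁻¹' {c x}, g x * cellAvg μ c f x ∂μ := by
    refine setIntegral_congr_fun (hc.meas _) fun y hy => ?_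
    have hy : c y = c x := hy
    simp only [hg hy, factorsThrough_cellAvg μ c f hy]
  have h2 : ∫ y in c ⁻¹' {c x}, g y * f y ∂μ = ∫ y in c ⁻¹' {c x}, g x * f y ∂μ := by
    refine setIntegral_congr_fun (hc.meas _) fun y hy => ?_
    have hy : c y = c x := hy
    simp only [hg hy]
  -- Null cells need no separate case: this identity between measure, average and integral holds for
  -- every set of finite measure.
  rw [h1, h2, setIntegral_const, integral_const_mul, ← measure_smul_setAverage f
    (measure_ne_top μ _)]
  simp only [cellAvg, mul_smul_comm]

theorem norm_cellAvg_le (μ : Measure X) (c : X → I) {𝕜 : Type} [RCLike 𝕜] (f : X → 𝕜) (x : X) :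
    ‖cellAvg μ c f x‖ ≤ cellAvg μ c (fun y => ‖f y‖) x := by
  simp only [cellAvg, setAverage_eq, norm_smul, norm_inv, smul_eq_mul, Real.norm_eq_abs,
    abs_of_nonneg measureReal_nonneg]
  gcongr
  exact norm_integral_le_integral_norm _

theorem cellAvg_nonneg (μ : Measure X) (c : X → I) {f : X → ℝ} (hf : ∀ x, 0 ≤ f x) (x : X) :
    0 ≤ cellAvg μ c f x := by
  simp only [cellAvg, setAverage_eq, smul_eq_mul]
  exact mul_nonneg (by positivity) (integral_nonneg hf)

theorem IsPartition.setIntegral_mul_cellAvg (hc : IsPartition c) {μ : Measure X}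
    [IsFiniteMeasure μ] {𝕜 : Type} [RCLike 𝕜] {g f : X → 𝕜} (hg : g.FactorsThrough c)
    (hf : Integrable f μ) {s : Set X} (hs : Function.FactorsThrough (· ∈ s) c) :
    ∫ x in s, g x * cellAvg μ c f x ∂μ = ∫ x in s, g x * f x ∂μ := by
  have h := hc.integral_mul_cellAvg (factorsThrough_indicator hs hg) hf
  simp only [← Set.indicator_mul_left] at h
  rwa [integral_indicator (hc.measurableSet hs), integral_indicator (hc.measurableSet hs)] at h

theorem IsPartition.setIntegral_cellAvg (hc : IsPartition c) {μ : Measure X}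
    [IsFiniteMeasure μ] {𝕜 : Type} [RCLike 𝕜] {f : X → 𝕜}
    (hf : Integrable f μ) {s : Set X} (hs : Function.FactorsThrough (· ∈ s) c) :
    ∫ x in s, cellAvg μ c f x ∂μ = ∫ x in s, f x ∂μ := by
  simpa using hc.setIntegral_mul_cellAvg (g := fun _ => (1 : 𝕜)) (fun _ _ _ => rfl) hf hs

end Level

/-! ### Energy of a stopped martingale -/

section Energy

variable {c : ℕ → X → I} {μ : Measure X}

/-- The mass `∫_s |f| + Λ μ(s)`. -/
noncomputable def mass (μ : Measure X) (f : X → ℂ) (Λ : ℝ) (s : Set X) : ℝ :=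
  ∫ x in s, ‖f x‖ ∂μ + Λ * μ.real s

theorem mass_nonneg {f : X → ℂ} {Λ : ℝ} (hΛ : 0 ≤ Λ) (s : Set X) : 0 ≤ mass μ f Λ s :=
  add_nonneg (integral_nonneg fun _ => norm_nonneg _) (mul_nonneg hΛ measureReal_nonneg)

variable [IsFiniteMeasure μ]

/-- Additivity is what turns the mass lost at each stopping step into a telescoping sum. -/
theorem mass_diff {f : X → ℂ} (hf : Integrable f μ) (Λ : ℝ) {s t : Set X} (hs : MeasurableSet s)
    (hts : s ⊆ t) : mass μ f Λ (t \ s) = mass μ f Λ t - mass μ f Λ s := by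
  simp only [mass, setIntegral_sdiff hs hf.norm.integrableOn hts, measureReal_sdiff (μ := μ) hts hs]
  ring

theorem IsPartition.mass_le {c : X → I} (hc : IsPartition c) {f : X → ℂ} (hf : Integrable f μ)
    {Λ : ℝ} {s : Set X} (hs : Function.FactorsThrough (· ∈ s) c)
    (h : ∀ x ∈ s, cellAvg μ c (fun y => ‖f y‖) x ≤ Λ) : mass μ f Λ s ≤ 2 * Λ * μ.real s := by
  have h1 : ∫ x in s, ‖f x‖ ∂μ ≤ Λ * μ.real s := by
    rw [← hc.setIntegral_cellAvg hf.norm hs]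
    calc ∫ x in s, cellAvg μ c (fun y => ‖f y‖) x ∂μ ≤ ∫ x in s, Λ ∂μ :=
          setIntegral_mono_on (hc.integrable μ (factorsThrough_cellAvg μ c _)).integrableOn
            (integrable_const _).integrableOn (hc.measurableSet hs) h
      _ = Λ * μ.real s := by rw [setIntegral_const, smul_eq_mul, mul_comm]
  simp only [mass]
  linarith

/-- A predictable multiple of a martingale difference, integrated over the cells that survive a
stopping rule, is controlled by the mass that leaves. -/
theorem norm_setIntegral_mul_diff_le (hc : IsPartitionSeq c) {f : X → ℂ} (hf : Integrable f μ)
    {k : ℕ} {s t : Set X} (hst : s ⊆ t) (ht : Function.FactorsThrough (· ∈ t) (c k))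
    (hs : Function.FactorsThrough (· ∈ s) (c (k + 1))) {Λ C : ℝ} (hC : 0 ≤ C)
    (hΛ : ∀ x ∈ t, cellAvg μ (c k) (fun y => ‖f y‖) x ≤ Λ)
    {P : X → ℂ} (hP : P.FactorsThrough (c k)) (hPC : ∀ x ∈ t, ‖P x‖ ≤ C) :
    ‖∫ x in s, P x * (cellAvg μ (c (k + 1)) f x - cellAvg μ (c k) f x) ∂μ‖
      ≤ C * (mass μ f Λ t - mass μ f Λ s) := by
  have hP' := hc.mono k.le_succ hP
  have ht' := hc.mono k.le_succ ht
  have hk := factorsThrough_cellAvg μ (c k) f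
  have hk' := hc.mono k.le_succ hk
  have hk1 := factorsThrough_cellAvg μ (c (k + 1)) f
  have hsm := (hc.part (k + 1)).measurableSet hs
  have htm := (hc.part k).measurableSet ht
  have i1 : Integrable (fun x => P x * cellAvg μ (c (k + 1)) f x) μ :=
    (hc.part (k + 1)).integrable_mul hP' ((hc.part (k + 1)).integrable μ hk1)
  have i2 : Integrable (fun x => P x * cellAvg μ (c k) f x) μ :=
    (hc.part k).integrable_mul hP ((hc.part k).integrable μ hk)
  have i3 : Integrable (fun x => P x * (cellAvg μ (c (k + 1)) f x - cellAvg μ (c k) f x)) μ := by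
    simp only [mul_sub]
    exact i1.sub i2
  -- The martingale property: `P` and `t` are both of level `k`, so against them each average may be
  -- replaced by `f`.
  have h0 : ∫ x in t, P x * (cellAvg μ (c (k + 1)) f x - cellAvg μ (c k) f x) ∂μ = 0 := by
    simp only [mul_sub]
    rw [integral_sub i1.integrableOn i2.integrableOn,
      (hc.part (k + 1)).setIntegral_mul_cellAvg hP' hf ht',
      (hc.part k).setIntegral_mul_cellAvg hP hf ht, sub_self]
  have hd := setIntegral_sdiff hsm i3.integrableOn hst
  rw [h0, zero_sub] at hd
  rw [← norm_neg, ← hd, ← mass_diff hf Λ hsm hst]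
  have hts : Function.FactorsThrough (· ∈ t \ s) (c (k + 1)) := by
    intro x y h
    have h1 : (x ∈ t) = (y ∈ t) := ht' h
    have h2 : (x ∈ s) = (y ∈ s) := hs h
    simp only [Set.mem_sdiff, h1, h2]
  have ia : Integrable (cellAvg μ (c (k + 1)) fun y => ‖f y‖) μ :=
    (hc.part (k + 1)).integrable μ (factorsThrough_cellAvg μ _ _)
  calc ‖∫ x in t \ s, P x * (cellAvg μ (c (k + 1)) f x - cellAvg μ (c k) f x) ∂μ‖
      ≤ ∫ x in t \ s, ‖P x * (cellAvg μ (c (k + 1)) f x - cellAvg μ (c k) f x)‖ ∂μ :=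
        norm_integral_le_integral_norm _
    -- On the leaving cells only the old average is bounded by `Λ`. The new one is kept under the
    -- integral, where it integrates to that of |f|, as `t \ s` is of level `k + 1`.
    _ ≤ ∫ x in t \ s, C * (cellAvg μ (c (k + 1)) (fun y => ‖f y‖) x + Λ) ∂μ := by
        refine setIntegral_mono_on i3.norm.integrableOn
          ((ia.add (integrable_const Λ)).const_mul C).integrableOn (htm.diff hsm) fun x hx => ?_
        rw [norm_mul]
        refine mul_le_mul (hPC x hx.1) ((norm_sub_le _ _).trans ?_) (norm_nonneg _) hC
        exact add_le_add (norm_cellAvg_le _ _ _ _)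
          ((norm_cellAvg_le _ _ _ _).trans (hΛ x hx.1))
    _ = C * mass μ f Λ (t \ s) := by
        rw [integral_const_mul, integral_add ia.integrableOn (integrable_const Λ).integrableOn,
          (hc.part (k + 1)).setIntegral_cellAvg hf.norm hts, setIntegral_const, smul_eq_mul, mass]
        ring

end Energy
end Partition

section Energy

variable {X I : Type} [MeasurableSpace X] {c : ℕ → X → I} {μ : Measure X} [IsFiniteMeasure μ]

/-- With `w` the old average, the cross term is a predictable coefficient times the martingale
difference. -/
theorem normSq_diff_eq (z w : ℂ) :
    ‖z - w‖ ^ 2 = ‖z‖ ^ 2 - ‖w‖ ^ 2 - 2 * (starRingEnd ℂ w * (z - w)).re := by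
  simp only [Complex.sq_norm, Complex.normSq_apply, Complex.sub_re, Complex.sub_im, Complex.mul_re,
    Complex.conj_re, Complex.conj_im]
  ring

/-- Energy estimate for a martingale that is stopped before its averages get large. -/
theorem sum_setIntegral_normSq_diff_le (hc : IsPartitionSeq c) {f : X → ℂ} (hf : Integrable f μ)
    {G : ℕ → Set X} (hG : ∀ k, Function.FactorsThrough (· ∈ G k) (c k))
    (hanti : ∀ k, G (k + 1) ⊆ G k) {Λ : ℝ} (hΛ : 0 ≤ Λ)
    (hb : ∀ k, ∀ x ∈ G k, cellAvg μ (c k) (fun y => ‖f y‖) x ≤ Λ) (N : ℕ) :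
    ∑ k ∈ Finset.range N,
      ∫ x in G (k + 1), ‖cellAvg μ (c (k + 1)) f x - cellAvg μ (c k) f x‖ ^ 2 ∂μ
      ≤ 7 * Λ ^ 2 * μ.real (G 0) := by
  have hm : ∀ k, MeasurableSet (G k) := fun k => (hc.part k).measurableSet (hG k)
  have hfb : ∀ k, ∀ x ∈ G k, ‖cellAvg μ (c k) f x‖ ≤ Λ := fun k x hx =>
    (norm_cellAvg_le _ _ _ _).trans (hb k x hx)
  set V : ℕ → ℝ := fun k => ∫ x in G k, ‖cellAvg μ (c k) f x‖ ^ 2 ∂μ with hV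
  have hint : ∀ k, Integrable (fun x => ‖cellAvg μ (c k) f x‖ ^ 2) μ := fun k =>
    (hc.part k).integrable μ fun x y h => by
      simp only [factorsThrough_cellAvg μ (c k) f h]
  have step : ∀ k, ∫ x in G (k + 1), ‖cellAvg μ (c (k + 1)) f x - cellAvg μ (c k) f x‖ ^ 2 ∂μ
      ≤ (V (k + 1) - V k) + 3 * Λ * (mass μ f Λ (G k) - mass μ f Λ (G (k + 1))) := by
    intro k
    have hP : Function.FactorsThrough (fun x => starRingEnd ℂ (cellAvg μ (c k) f x)) (c k) :=
      fun x y h => by simp only [factorsThrough_cellAvg μ (c k) f h]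
    have h1 := norm_setIntegral_mul_diff_le hc hf (hanti k) (hG k) (hG (k + 1)) hΛ (hb k) hP
      (fun x hx => by simpa using hfb k x hx)
    have hii : Integrable (fun x => starRingEnd ℂ (cellAvg μ (c k) f x) *
        (cellAvg μ (c (k + 1)) f x - cellAvg μ (c k) f x)) μ :=
      (hc.part (k + 1)).integrable μ fun x y h => by
        simp only [factorsThrough_cellAvg μ (c (k + 1)) f h,
          hc.mono k.le_succ (factorsThrough_cellAvg μ (c k) f) h]
    have h2 : ∫ x in G (k + 1), ‖cellAvg μ (c (k + 1)) f x - cellAvg μ (c k) f x‖ ^ 2 ∂μ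
        = V (k + 1) - ∫ x in G (k + 1), ‖cellAvg μ (c k) f x‖ ^ 2 ∂μ
          - 2 * (∫ x in G (k + 1), starRingEnd ℂ (cellAvg μ (c k) f x) *
            (cellAvg μ (c (k + 1)) f x - cellAvg μ (c k) f x) ∂μ).re := by
      have hre := integral_re (𝕜 := ℂ) (hii.integrableOn (s := G (k + 1)))
      simp only [RCLike.re_to_complex] at hre
      rw [← hre, ← integral_const_mul, hV]
      simp only [normSq_diff_eq]
      rw [integral_sub, integral_sub]
      · exact (hint (k + 1)).integrableOn
      · exact (hint k).integrableOn
      · exact ((hint (k + 1)).sub (hint k)).integrableOn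
      · exact (hii.re.const_mul 2).integrableOn
    -- Together with twice the cross term, each of size `Λ` times the lost mass, this makes the
    -- factor `3 * Λ` in `step`.
    have h3 : V k - ∫ x in G (k + 1), ‖cellAvg μ (c k) f x‖ ^ 2 ∂μ
        ≤ Λ * (mass μ f Λ (G k) - mass μ f Λ (G (k + 1))) := by
      rw [← mass_diff hf Λ (hm (k + 1)) (hanti k), hV,
        ← setIntegral_sdiff (hm (k + 1)) (hint k).integrableOn (hanti k)]
      calc ∫ x in G k \ G (k + 1), ‖cellAvg μ (c k) f x‖ ^ 2 ∂μ
          ≤ ∫ x in G k \ G (k + 1), Λ ^ 2 ∂μ :=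
            setIntegral_mono_on (hint k).integrableOn (integrable_const _).integrableOn
              ((hm k).diff (hm (k + 1))) fun x hx =>
                pow_le_pow_left₀ (norm_nonneg _) (hfb k x hx.1) 2
        _ = Λ * (Λ * μ.real (G k \ G (k + 1))) := by
            rw [setIntegral_const, smul_eq_mul]; ring
        _ ≤ Λ * mass μ f Λ (G k \ G (k + 1)) := by
            refine mul_le_mul_of_nonneg_left ?_ hΛ
            exact le_add_of_nonneg_left (integral_nonneg fun _ => norm_nonneg _)
    have h4 := (Complex.abs_re_le_norm _).trans h1
    rw [h2]
    have h5 := neg_le_of_abs_le h4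
    linarith
  calc _ ≤ ∑ k ∈ Finset.range N, ((V (k + 1) - V k) +
        3 * Λ * (mass μ f Λ (G k) - mass μ f Λ (G (k + 1)))) := Finset.sum_le_sum fun k _ => step k
    _ = (V N - V 0) + 3 * Λ * (mass μ f Λ (G 0) - mass μ f Λ (G N)) := by
        rw [Finset.sum_add_distrib, Finset.sum_range_sub, ← Finset.mul_sum, Finset.sum_range_sub']
    _ ≤ Λ ^ 2 * μ.real (G 0) + 3 * Λ * (2 * Λ * μ.real (G 0)) := by
        have hN : V N ≤ Λ ^ 2 * μ.real (G 0) := by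
          have hsub : G N ⊆ G 0 := antitone_nat_of_succ_le hanti (Nat.zero_le N)
          calc V N ≤ ∫ x in G N, Λ ^ 2 ∂μ :=
                setIntegral_mono_on (hint N).integrableOn (integrable_const _).integrableOn
                  (hm N) fun x hx => pow_le_pow_left₀ (norm_nonneg _) (hfb N x hx) 2
            _ = Λ ^ 2 * μ.real (G N) := by rw [setIntegral_const, smul_eq_mul, mul_comm]
            _ ≤ _ := mul_le_mul_of_nonneg_left (measureReal_mono hsub) (sq_nonneg _)
        have h0 : 0 ≤ V 0 := integral_nonneg fun _ => by positivity
        have hm0 := (hc.part 0).mass_le hf (hG 0) (hb 0)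
        have hmN := mass_nonneg (μ := μ) (f := f) hΛ (G N)
        have : 3 * Λ * (mass μ f Λ (G 0) - mass μ f Λ (G N)) ≤ 3 * Λ * (2 * Λ * μ.real (G 0)) :=
          mul_le_mul_of_nonneg_left (by linarith) (by linarith)
        linarith
    _ = 7 * Λ ^ 2 * μ.real (G 0) := by ring

end Energy

/-! ### Quotients of martingales -/

section Pointwise

theorem norm_div_le_two_mul {a β : ℂ} (hβ : 1 / 2 ≤ ‖β‖) : ‖a / β‖ ≤ 2 * ‖a‖ := by
  rw [norm_div, div_le_iff₀ (by linarith)]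
  nlinarith [norm_nonneg a]

/-- Writing the increment as (a' - a)/β - (a'/β')(β' - β)/β requires a bound on the new numerator
only. -/
theorem norm_div_sub_div_le {a a' β β' : ℂ} {l : ℝ} (ha' : ‖a'‖ ≤ l)
    (hβ : 1 / 2 ≤ ‖β‖) (hβ' : 1 / 2 ≤ ‖β'‖) :
    ‖a' / β' - a / β‖ ≤ 2 * ‖a' - a‖ + 4 * l * ‖β' - β‖ := by
  have h0 : β ≠ 0 := norm_pos_iff.1 (by linarith)
  have h0' : β' ≠ 0 := norm_pos_iff.1 (by linarith)
  have e : a' / β' - a / β = (a' - a) / β - (a' / β') * (β' - β) / β := by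
    field_simp
    ring
  rw [e]
  refine (norm_sub_le _ _).trans (add_le_add (norm_div_le_two_mul hβ) ?_)
  refine (norm_div_le_two_mul hβ).trans ?_
  rw [norm_mul]
  have h1 := norm_div_le_two_mul (a := a') hβ'
  nlinarith [norm_nonneg (β' - β), mul_le_mul_of_nonneg_right (h1.trans
    (mul_le_mul_of_nonneg_left ha' zero_le_two)) (norm_nonneg (β' - β))]

/-- Second order expansion of `z ↦ ‖z‖ ^ 2` along the increment of a quotient. -/
theorem normSq_add_quotient_increment_le {S η a a' β β' : ℂ} {t l : ℝ} (hl : 0 < l)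
    (ha' : ‖a'‖ ≤ l) (hβ : 1 / 2 ≤ ‖β‖) (hβ' : 1 / 2 ≤ ‖β'‖) (hη : ‖η‖ ≤ 1)
    (hS : ‖starRingEnd ℂ S * η‖ ≤ t) :
    ‖S + η * (a' / β' - a / β)‖ ^ 2 ≤ ‖S‖ ^ 2
      + 2 * (starRingEnd ℂ S * η / β * (a' - a)).re
      + 2 * (-(starRingEnd ℂ S * η * a / β ^ 2) * (β' - β)).re
      + (4 * t / l + 8) * ‖a' - a‖ ^ 2 + (20 * t * l + 32 * l ^ 2) * ‖β' - β‖ ^ 2 := by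
  have h0 : β ≠ 0 := norm_pos_iff.1 (by linarith)
  have h0' : β' ≠ 0 := norm_pos_iff.1 (by linarith)
  have ht : 0 ≤ t := (norm_nonneg _).trans hS
  have hw := norm_div_sub_div_le (a := a) ha' hβ hβ'
  set w := a' / β' - a / β with hwdef
  have e1 : ‖S + η * w‖ ^ 2 = ‖S‖ ^ 2 + 2 * (starRingEnd ℂ S * η * w).re + ‖η * w‖ ^ 2 := by
    simp only [Complex.sq_norm, Complex.normSq_apply, Complex.add_re, Complex.add_im,
      Complex.mul_re, Complex.mul_im, Complex.conj_re, Complex.conj_im]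
    ring
  -- The exact identity w = (a' - a)/β - a(β' - β)/β² - (β' - β)w/β. The first two coefficients
  -- involve old data only, and the last term is quadratic in the increments.
  have e2 : starRingEnd ℂ S * η * w = starRingEnd ℂ S * η / β * (a' - a)
      + -(starRingEnd ℂ S * η * a / β ^ 2) * (β' - β) - starRingEnd ℂ S * η * ((β' - β) * w / β) := by
    rw [hwdef]
    field_simp
    ring
  have hu := norm_nonneg (a' - a)
  have hv := norm_nonneg (β' - β)
  set u := ‖a' - a‖
  set v := ‖β' - β‖
  have h1 : ‖starRingEnd ℂ S * η * ((β' - β) * w / β)‖ ≤ t * (2 * (v * (2 * u + 4 * l * v))) := by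
    rw [norm_mul]
    refine mul_le_mul hS ((norm_div_le_two_mul hβ).trans ?_) (norm_nonneg _) ht
    rw [norm_mul]
    exact mul_le_mul_of_nonneg_left (mul_le_mul_of_nonneg_left hw hv) zero_le_two
  have h2 : ‖η * w‖ ^ 2 ≤ (2 * u + 4 * l * v) ^ 2 := by
    refine pow_le_pow_left₀ (norm_nonneg _) ?_ 2
    rw [norm_mul]
    exact (mul_le_of_le_one_left (norm_nonneg _) hη).trans hw
  have h3 := (abs_le.1 ((Complex.abs_re_le_norm _).trans h1)).1
  rw [e1, e2, Complex.sub_re, Complex.add_re]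
  -- Weighted by `l` because numerators have size `l` and denominators size one, so `u` compares
  -- with `l * v`.
  have h4 : 8 * t * (u * v) ≤ 4 * t / l * u ^ 2 + 4 * t * l * v ^ 2 := by
    have : 4 * t / l * u ^ 2 + 4 * t * l * v ^ 2 - 8 * t * (u * v)
        = 4 * t / l * (u - l * v) ^ 2 := by
      field_simp
      ring
    have h5 : 0 ≤ 4 * t / l * (u - l * v) ^ 2 := by positivity
    linarith
  nlinarith [sq_nonneg (2 * u - 4 * l * v)]

end Pointwise

/-! ### Stopped sums of increments of a quotient -/

section Quotient

variable {X I : Type}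

/-- The partial sums of `d`, frozen as soon as they exceed `t`. -/
noncomputable def stoppedSum (d : ℕ → X → ℂ) (t : ℝ) : ℕ → X → ℂ
  | 0, _ => 0
  | k + 1, x => if ‖stoppedSum d t k x‖ ≤ t then stoppedSum d t k x + d k x
      else stoppedSum d t k x

theorem stoppedSum_eq_sum {d : ℕ → X → ℂ} {t : ℝ} {x : X} {k : ℕ}
    (h : ∀ j < k, ‖∑ i ∈ Finset.range j, d i x‖ ≤ t) :
    stoppedSum d t k x = ∑ i ∈ Finset.range k, d i x := by
  induction k with
  | zero => simp [stoppedSum]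
  | succ k ih =>
    rw [stoppedSum, ih fun j hj => h j (hj.trans k.lt_succ_self), if_pos (h k k.lt_succ_self),
      Finset.sum_range_succ]

/-- The step that crosses `t` is still carried out and the value is kept from then on. So the
stopped sum at the final index detects every earlier crossing, and Chebyshev for it gives a maximal
inequality. -/
theorem lt_norm_stoppedSum {d : ℕ → X → ℂ} {t : ℝ} {x : X} {N : ℕ}
    (h : ∃ k ≤ N, t < ‖∑ i ∈ Finset.range k, d i x‖) : t < ‖stoppedSum d t N x‖ := by
  classical
  obtain ⟨h1, h2⟩ := Nat.find_spec h
  have h3 : t < ‖stoppedSum d t (Nat.find h) x‖ := by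
    rw [stoppedSum_eq_sum fun j hj => ?_]
    · exact h2
    · by_contra hlt
      exact Nat.find_min h hj ⟨(hj.le).trans h1, not_le.1 hlt⟩
  have h4 : ∀ k, Nat.find h ≤ k → t < ‖stoppedSum d t k x‖ := by
    intro k hk
    induction k, hk using Nat.le_induction with
    | base => exact h3
    | succ k _ ih => rw [stoppedSum, if_neg (not_le.2 ih)]; exact ih
  exact h4 N h1

variable [MeasurableSpace X] {c : ℕ → X → I} {μ : Measure X}

/-- The quotient of the averages of `h` and `b` over the cells of a partition. -/
noncomputable def cellQuot (μ : Measure X) (c : X → I) (h b : X → ℂ) (x : X) : ℂ :=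
  cellAvg μ c h x / cellAvg μ c b x

theorem factorsThrough_cellQuot (μ : Measure X) (c : X → I) (h b : X → ℂ) :
    (cellQuot μ c h b).FactorsThrough c := fun x y hxy => by
  simp only [cellQuot, factorsThrough_cellAvg μ c h hxy, factorsThrough_cellAvg μ c b hxy]

/-- The increment of the quotient between two levels, multiplied by `ε` and restricted to `s`. -/
noncomputable def quotIncrement (μ : Measure X) (c c' : X → I) (h b : X → ℂ) (ε : X → ℂ)
    (s : Set X) : X → ℂ :=
  s.indicator fun x => ε x * (cellQuot μ c' h b x - cellQuot μ c h b x)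

theorem IsPartitionSeq.factorsThrough_quotIncrement (hc : IsPartitionSeq c) (μ : Measure X)
    (h b : X → ℂ) {k : ℕ} {ε : X → ℂ} (hε : ε.FactorsThrough (c k)) {s : Set X}
    (hs : Function.FactorsThrough (· ∈ s) (c (k + 1))) :
    (quotIncrement μ (c k) (c (k + 1)) h b ε s).FactorsThrough (c (k + 1)) := by
  refine factorsThrough_indicator hs fun x y hxy => ?_
  simp only [hc.mono k.le_succ hε hxy, factorsThrough_cellQuot μ (c (k + 1)) h b hxy,
    hc.mono k.le_succ (factorsThrough_cellQuot μ (c k) h b) hxy]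

theorem IsPartitionSeq.factorsThrough_stoppedSum (hc : IsPartitionSeq c) {d : ℕ → X → ℂ}
    (hd : ∀ k, (d k).FactorsThrough (c (k + 1))) (t : ℝ) (k : ℕ) :
    (stoppedSum d t k).FactorsThrough (c k) := by
  induction k with
  | zero => exact fun _ _ _ => rfl
  | succ k ih =>
    intro x y hxy
    simp only [stoppedSum, hc.mono k.le_succ ih hxy, hd k hxy]

variable [IsFiniteMeasure μ]

/-- Second moment bound for the stopped sums of increments of a quotient of martingales. -/
theorem integral_normSq_stoppedSum_le (hc : IsPartitionSeq c) {h b : X → ℂ}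
    (hh : Integrable h μ) (hb : Integrable b μ) {G : ℕ → Set X}
    (hG : ∀ k, Function.FactorsThrough (· ∈ G k) (c k)) (hanti : ∀ k, G (k + 1) ⊆ G k)
    {l L t : ℝ} (hl : 0 < l) (hL : 1 ≤ L) (ht : 0 ≤ t)
    (hGh : ∀ k, ∀ x ∈ G k, cellAvg μ (c k) (fun y => ‖h y‖) x ≤ l)
    (hGb : ∀ k, ∀ x ∈ G k, cellAvg μ (c k) (fun y => ‖b y‖) x ≤ L)
    (hGb' : ∀ k, ∀ x ∈ G k, 1 / 2 ≤ ‖cellAvg μ (c k) b x‖)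
    {ε : ℕ → X → ℂ} (hε : ∀ k, (ε k).FactorsThrough (c k)) (hε1 : ∀ k x, ‖ε k x‖ ≤ 1) (N : ℕ) :
    ∫ x, ‖stoppedSum (fun k => quotIncrement μ (c k) (c (k + 1)) h b (ε k) (G (k + 1))) t N x‖ ^ 2
      ∂μ ≤ 280 * L ^ 2 * (t * l + l ^ 2) * μ.real (G 0) := by
  set d := fun k => quotIncrement μ (c k) (c (k + 1)) h b (ε k) (G (k + 1)) with hd
  have hdl : ∀ k, (d k).FactorsThrough (c (k + 1)) := fun k =>
    hc.factorsThrough_quotIncrement μ h b (hε k) (hG (k + 1))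
  set S := stoppedSum d t with hS
  have hSl : ∀ k, (S k).FactorsThrough (c k) := hc.factorsThrough_stoppedSum hdl t
  have hm : ∀ k, MeasurableSet (G k) := fun k => (hc.part k).measurableSet (hG k)
  -- The freezing rule is absorbed into the coefficient. It depends only on level `k`, so `η` stays
  -- predictable, and the product of `S` and `η` is bounded by `t` although `S` may overshoot.
  set η : ℕ → X → ℂ := fun k x => if ‖S k x‖ ≤ t then ε k x else 0 with hη
  have hηl : ∀ k, (η k).FactorsThrough (c k) := fun k x y hxy => by
    simp only [hη, hSl k hxy, hε k hxy]
  have hη1 : ∀ k x, ‖η k x‖ ≤ 1 := fun k x => by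
    simp only [hη]
    split_ifs
    · exact hε1 k x
    · simp
  have hηS : ∀ k x, ‖starRingEnd ℂ (S k x) * η k x‖ ≤ t := fun k x => by
    simp only [hη]
    split_ifs with hif
    · rw [norm_mul, RCLike.norm_conj]
      exact (mul_le_of_le_one_right (norm_nonneg _) (hε1 k x)).trans hif
    · simpa using ht
  have hSs : ∀ k x, x ∈ G (k + 1) → S (k + 1) x = S k x +
      η k x * (cellQuot μ (c (k + 1)) h b x - cellQuot μ (c k) h b x) := fun k x hx => by
    simp only [hS, stoppedSum, hη, hd, quotIncrement, Set.indicator_of_mem hx]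
    split_ifs <;> simp
  have hSn : ∀ k x, x ∉ G (k + 1) → S (k + 1) x = S k x := fun k x hx => by
    simp only [hS, stoppedSum, hd, quotIncrement, Set.indicator_of_notMem hx]
    split_ifs <;> simp
  set u : ℕ → X → ℂ := fun k x => cellAvg μ (c (k + 1)) h x - cellAvg μ (c k) h x with hu
  set v : ℕ → X → ℂ := fun k x => cellAvg μ (c (k + 1)) b x - cellAvg μ (c k) b x with hv
  have hul : ∀ k, (u k).FactorsThrough (c (k + 1)) := fun k x y hxy => by
    simp only [hu, factorsThrough_cellAvg μ _ h hxy,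
      hc.mono k.le_succ (factorsThrough_cellAvg μ (c k) h) hxy]
  have hvl : ∀ k, (v k).FactorsThrough (c (k + 1)) := fun k x y hxy => by
    simp only [hv, factorsThrough_cellAvg μ _ b hxy,
      hc.mono k.le_succ (factorsThrough_cellAvg μ (c k) b) hxy]
  -- `P` and `Q` are the predictable coefficients of the differences of `h` and `b` in the second
  -- order expansion.
  set P : ℕ → X → ℂ := fun k x => starRingEnd ℂ (S k x) * η k x / cellAvg μ (c k) b x with hP
  set Q : ℕ → X → ℂ := fun k x =>
    -(starRingEnd ℂ (S k x) * η k x * cellAvg μ (c k) h x / cellAvg μ (c k) b x ^ 2) with hQ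
  have hPl : ∀ k, (P k).FactorsThrough (c k) := fun k x y hxy => by
    simp only [hP, hSl k hxy, hηl k hxy, factorsThrough_cellAvg μ _ b hxy]
  have hQl : ∀ k, (Q k).FactorsThrough (c k) := fun k x y hxy => by
    simp only [hQ, hSl k hxy, hηl k hxy, factorsThrough_cellAvg μ _ b hxy,
      factorsThrough_cellAvg μ _ h hxy]
  have hPb : ∀ k, ∀ x ∈ G k, ‖P k x‖ ≤ 2 * t := fun k x hx =>
    (norm_div_le_two_mul (hGb' k x hx)).trans (mul_le_mul_of_nonneg_left (hηS k x) zero_le_two)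
  have hQb : ∀ k, ∀ x ∈ G k, ‖Q k x‖ ≤ 4 * t * l := fun k x hx => by
    have h1 := hGb' k x hx
    have h2 := (norm_cellAvg_le μ (c k) h x).trans (hGh k x hx)
    have h3 := mul_le_mul (hηS k x) h2 (norm_nonneg _) ht
    simp only [hQ, norm_neg]
    rw [sq, ← div_div]
    refine (norm_div_le_two_mul h1).trans ?_
    have h4 := norm_div_le_two_mul
      (a := starRingEnd ℂ (S k x) * η k x * cellAvg μ (c k) h x) h1
    rw [norm_mul (starRingEnd ℂ (S k x) * η k x)] at h4
    linarith
  have hPu : ∀ k, Integrable (fun x => P k x * u k x) μ := fun k =>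
    (hc.part (k + 1)).integrable μ fun x y hxy => by
      simp only [hc.mono k.le_succ (hPl k) hxy, hul k hxy]
  have hQv : ∀ k, Integrable (fun x => Q k x * v k x) μ := fun k =>
    (hc.part (k + 1)).integrable μ fun x y hxy => by
      simp only [hc.mono k.le_succ (hQl k) hxy, hvl k hxy]
  have hu2 : ∀ k, Integrable (fun x => ‖u k x‖ ^ 2) μ := fun k =>
    (hc.part (k + 1)).integrable μ fun x y hxy => by simp only [hul k hxy]
  have hv2 : ∀ k, Integrable (fun x => ‖v k x‖ ^ 2) μ := fun k =>
    (hc.part (k + 1)).integrable μ fun x y hxy => by simp only [hvl k hxy]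
  have hS2 : ∀ k, Integrable (fun x => ‖S k x‖ ^ 2) μ := fun k =>
    (hc.part k).integrable μ fun x y hxy => by simp only [hSl k hxy]
  set K₁ := 4 * t / l + 8 with hK₁
  set K₂ := 20 * t * l + 32 * l ^ 2 with hK₂
  have step : ∀ k, ∫ x, ‖S (k + 1) x‖ ^ 2 ∂μ - ∫ x, ‖S k x‖ ^ 2 ∂μ ≤
      4 * t * (mass μ h l (G k) - mass μ h l (G (k + 1)))
      + 8 * t * l * (mass μ b L (G k) - mass μ b L (G (k + 1)))
      + K₁ * ∫ x in G (k + 1), ‖u k x‖ ^ 2 ∂μ + K₂ * ∫ x in G (k + 1), ‖v k x‖ ^ 2 ∂μ := by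
    intro k
    have h1 := norm_setIntegral_mul_diff_le hc hh (hanti k) (hG k) (hG (k + 1))
      (by positivity : 0 ≤ 2 * t) (hGh k) (hPl k) (hPb k)
    have h2 := norm_setIntegral_mul_diff_le hc hb (hanti k) (hG k) (hG (k + 1))
      (by positivity : 0 ≤ 4 * t * l) (hGb k) (hQl k) (hQb k)
    have h1' := (le_abs_self _).trans ((Complex.abs_re_le_norm _).trans h1)
    have h2' := (le_abs_self _).trans ((Complex.abs_re_le_norm _).trans h2)
    have r1 := integral_re (𝕜 := ℂ) ((hPu k).integrableOn (s := G (k + 1)))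
    have r2 := integral_re (𝕜 := ℂ) ((hQv k).integrableOn (s := G (k + 1)))
    simp only [RCLike.re_to_complex] at r1 r2
    have h3 : ∫ x, ‖S (k + 1) x‖ ^ 2 ∂μ - ∫ x, ‖S k x‖ ^ 2 ∂μ
        = ∫ x in G (k + 1), (‖S (k + 1) x‖ ^ 2 - ‖S k x‖ ^ 2) ∂μ := by
      rw [← integral_sub (hS2 _) (hS2 _), ← integral_indicator (hm (k + 1))]
      refine integral_congr_ae (Filter.Eventually.of_forall fun x => ?_)
      by_cases hx : x ∈ G (k + 1)
      · simp [Set.indicator_of_mem hx]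
      · simp [Set.indicator_of_notMem hx, hSn k x hx]
    have i1 := ((hPu k).re.const_mul 2).integrableOn (s := G (k + 1))
    have i2 := ((hQv k).re.const_mul 2).integrableOn (s := G (k + 1))
    have i3 := ((hu2 k).const_mul K₁).integrableOn (s := G (k + 1))
    have i4 := ((hv2 k).const_mul K₂).integrableOn (s := G (k + 1))
    simp only [RCLike.re_to_complex] at i1 i2
    have i12 : IntegrableOn (fun x => 2 * (P k x * u k x).re + 2 * (Q k x * v k x).re)
      (G (k + 1)) μ := i1.add i2
    have i123 : IntegrableOn (fun x => 2 * (P k x * u k x).re + 2 * (Q k x * v k x).re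
      + K₁ * ‖u k x‖ ^ 2) (G (k + 1)) μ := i12.add i3
    rw [h3]
    calc ∫ x in G (k + 1), (‖S (k + 1) x‖ ^ 2 - ‖S k x‖ ^ 2) ∂μ
        ≤ ∫ x in G (k + 1), (2 * (P k x * u k x).re + 2 * (Q k x * v k x).re
          + K₁ * ‖u k x‖ ^ 2 + K₂ * ‖v k x‖ ^ 2) ∂μ := by
          refine setIntegral_mono_on ((hS2 _).sub (hS2 _)).integrableOn
            (i123.add i4) (hm _) fun x hx => ?_
          have h5 := normSq_add_quotient_increment_le (a := cellAvg μ (c k) h x) hl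
            ((norm_cellAvg_le μ (c (k + 1)) h x).trans (hGh (k + 1) x hx))
            (hGb' k x (hanti k hx)) (hGb' (k + 1) x hx) (hη1 k x) (hηS k x)
          rw [hSs k x hx]
          simp only [cellQuot]
          linarith
      _ = 2 * (∫ x in G (k + 1), P k x * u k x ∂μ).re + 2 * (∫ x in G (k + 1), Q k x * v k x ∂μ).re
          + K₁ * ∫ x in G (k + 1), ‖u k x‖ ^ 2 ∂μ + K₂ * ∫ x in G (k + 1), ‖v k x‖ ^ 2 ∂μ := by
          rw [integral_add i123 i4, integral_add i12 i3, integral_add i1 i2, integral_const_mul,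
            integral_const_mul, integral_const_mul, integral_const_mul, r1, r2]
      _ ≤ _ := by linarith
  have hsum := Finset.sum_le_sum fun k (_ : k ∈ Finset.range N) => step k
  have e1 := sum_setIntegral_normSq_diff_le hc hh hG hanti hl.le hGh N
  have e2 := sum_setIntegral_normSq_diff_le hc hb hG hanti (zero_le_one.trans hL) hGb N
  rw [Finset.sum_range_sub fun k => ∫ x, ‖S k x‖ ^ 2 ∂μ] at hsum
  simp only [Finset.sum_add_distrib, ← Finset.mul_sum] at hsum
  rw [Finset.sum_range_sub' fun k => mass μ h l (G k),
    Finset.sum_range_sub' fun k => mass μ b L (G k)] at hsum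
  have hS0 : ∫ x, ‖S 0 x‖ ^ 2 ∂μ = 0 := by simp [hS, stoppedSum]
  have m1 := (hc.part 0).mass_le hh (hG 0) (hGh 0)
  have m2 := (hc.part 0).mass_le hb (hG 0) (hGb 0)
  have m3 := mass_nonneg (μ := μ) (f := h) hl.le (G N)
  have m4 := mass_nonneg (μ := μ) (f := b) (zero_le_one.trans hL) (G N)
  have hM : 0 ≤ μ.real (G 0) := measureReal_nonneg
  set M := μ.real (G 0)
  have q1 : 4 * t * (mass μ h l (G 0) - mass μ h l (G N)) ≤ 4 * t * (2 * l * M) :=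
    mul_le_mul_of_nonneg_left (by linarith) (by positivity)
  have q2 : 8 * t * l * (mass μ b L (G 0) - mass μ b L (G N)) ≤ 8 * t * l * (2 * L * M) :=
    mul_le_mul_of_nonneg_left (by linarith) (by positivity)
  have q3 := mul_le_mul_of_nonneg_left e1 (by positivity : 0 ≤ K₁)
  have q4 := mul_le_mul_of_nonneg_left e2 (by positivity : 0 ≤ K₂)
  have q5 : K₁ * (7 * l ^ 2 * M) = (28 * (t * l) + 56 * l ^ 2) * M := by
    rw [hK₁]; field_simp; ring
  have q6 : K₂ * (7 * L ^ 2 * M) = (140 * (t * l) + 224 * l ^ 2) * L ^ 2 * M := by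
    rw [hK₂]; ring
  have hLL : L ≤ L ^ 2 := by nlinarith
  have hL1 : 1 ≤ L ^ 2 := by nlinarith
  have htl : 0 ≤ t * l * M := by positivity
  have hll : 0 ≤ l ^ 2 * M := by positivity
  -- With 1 ≤ L ≤ L², the coefficients of `l ^ 2` add up to 56 + 224 = 280, and those of `t * l` to
  -- less.
  calc ∫ x, ‖S N x‖ ^ 2 ∂μ
      ≤ 8 * (t * l * M) + 16 * (t * l * M) * L + (28 * (t * l * M) + 56 * (l ^ 2 * M))
        + (140 * (t * l * M) + 224 * (l ^ 2 * M)) * L ^ 2 := by linarith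
    _ ≤ 280 * L ^ 2 * (t * l + l ^ 2) * M := by
        have a1 := mul_le_mul_of_nonneg_left hLL htl
        have a2 := mul_le_mul_of_nonneg_left hL1 htl
        have a3 := mul_le_mul_of_nonneg_left hL1 hll
        nlinarith

/-- Weak type bound for the maximal partial sums of increments of a quotient of martingales. -/
theorem measureReal_lt_norm_sum_le (hc : IsPartitionSeq c) {h b : X → ℂ}
    (hh : Integrable h μ) (hb : Integrable b μ) {G : ℕ → Set X}
    (hG : ∀ k, Function.FactorsThrough (· ∈ G k) (c k)) (hanti : ∀ k, G (k + 1) ⊆ G k)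
    {l L t : ℝ} (hl : 0 < l) (hL : 1 ≤ L) (ht : 0 < t)
    (hGh : ∀ k, ∀ x ∈ G k, cellAvg μ (c k) (fun y => ‖h y‖) x ≤ l)
    (hGb : ∀ k, ∀ x ∈ G k, cellAvg μ (c k) (fun y => ‖b y‖) x ≤ L)
    (hGb' : ∀ k, ∀ x ∈ G k, 1 / 2 ≤ ‖cellAvg μ (c k) b x‖)
    {ε : ℕ → X → ℂ} (hε : ∀ k, (ε k).FactorsThrough (c k)) (hε1 : ∀ k x, ‖ε k x‖ ≤ 1) (N : ℕ) :
    t ^ 2 * μ.real {x | ∃ k ≤ N, t < ‖∑ i ∈ Finset.range k,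
      quotIncrement μ (c i) (c (i + 1)) h b (ε i) (G (i + 1)) x‖}
      ≤ 280 * L ^ 2 * (t * l + l ^ 2) * μ.real (G 0) := by
  refine le_trans ?_ (integral_normSq_stoppedSum_le hc hh hb hG hanti hl hL ht.le hGh hGb hGb'
    hε hε1 N)
  set S := stoppedSum (fun k => quotIncrement μ (c k) (c (k + 1)) h b (ε k) (G (k + 1))) t N
  have hSl : S.FactorsThrough (c N) := hc.factorsThrough_stoppedSum
    (fun k => hc.factorsThrough_quotIncrement μ h b (hε k) (hG (k + 1))) t N
  have hi : Integrable (fun x => ‖S x‖ ^ 2) μ :=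
    (hc.part N).integrable μ fun x y hxy => by simp only [hSl hxy]
  refine le_trans ?_ (mul_meas_ge_le_integral_of_nonneg
    (Filter.Eventually.of_forall fun x => by positivity) hi (t ^ 2))
  refine mul_le_mul_of_nonneg_left (measureReal_mono ?_) (by positivity)
  intro x hx
  exact pow_le_pow_left₀ ht.le (lt_norm_stoppedSum hx).le 2

end Quotient

/-! ### Good-`λ` inequality and `L^p` bounds -/

section RunningMax

variable {X I : Type}

/-- The running maximum `max_{k ≤ N} g k`. -/
noncomputable def runningMax (g : ℕ → X → ℝ) (N : ℕ) (x : X) : ℝ :=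
  (Finset.range (N + 1)).sup' Finset.nonempty_range_add_one fun k => g k x

theorem lt_runningMax_iff {g : ℕ → X → ℝ} {N : ℕ} {x : X} {t : ℝ} :
    t < runningMax g N x ↔ ∃ k ≤ N, t < g k x := by
  rw [runningMax, Finset.lt_sup'_iff]
  simp

theorem runningMax_le_iff {g : ℕ → X → ℝ} {N : ℕ} {x : X} {t : ℝ} :
    runningMax g N x ≤ t ↔ ∀ k ≤ N, g k x ≤ t := by
  rw [runningMax, Finset.sup'_le_iff]
  simp

theorem le_runningMax (g : ℕ → X → ℝ) {k N : ℕ} (hk : k ≤ N) (x : X) :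
    g k x ≤ runningMax g N x :=
  runningMax_le_iff.1 le_rfl k hk

theorem runningMax_nonneg {g : ℕ → X → ℝ} (hg : ∀ k x, 0 ≤ g k x) (N : ℕ) (x : X) :
    0 ≤ runningMax g N x :=
  (hg 0 x).trans (le_runningMax g (Nat.zero_le N) x)

/-- The set where `g` exceeds `t` for the first time at index `m`. -/
def firstExceed (g : ℕ → X → ℝ) (t : ℝ) (m : ℕ) : Set X :=
  {x | t < g m x ∧ ∀ i < m, g i x ≤ t}

theorem pairwise_disjoint_firstExceed (g : ℕ → X → ℝ) (t : ℝ) :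
    Pairwise (Function.onFun Disjoint (firstExceed g t)) := by
  intro i j hij
  rw [Function.onFun, Set.disjoint_left]
  rintro x ⟨h1, h2⟩ ⟨h3, h4⟩
  rcases lt_or_gt_of_ne hij with h | h
  · exact absurd (h4 i h) (not_le.2 h1)
  · exact absurd (h2 j h) (not_le.2 h3)

/-- Splitting by the first crossing index gives disjoint pieces, each of the level of its index, on
which martingale arguments can be restarted. -/
theorem setOf_lt_runningMax_eq (g : ℕ → X → ℝ) (t : ℝ) (N : ℕ) :
    {x | t < runningMax g N x} = ⋃ m ∈ Finset.range (N + 1), firstExceed g t m := by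
  classical
  ext x
  simp only [Set.mem_ofPred_eq, lt_runningMax_iff, Set.mem_iUnion, Finset.mem_range, firstExceed,
    exists_prop, Nat.lt_succ_iff]
  constructor
  · intro h
    have h' : ∃ k, t < g k x := h.imp fun k hk => hk.2
    obtain ⟨k, hk, hkt⟩ := h
    exact ⟨Nat.find h', (Nat.find_min' h' hkt).trans hk, Nat.find_spec h',
      fun i hi => not_lt.1 (Nat.find_min h' hi)⟩
  · rintro ⟨m, hm, h, -⟩
    exact ⟨m, hm, h⟩

theorem IsPartitionSeq.factorsThrough_runningMax [MeasurableSpace X] {c : ℕ → X → I}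
    (hc : IsPartitionSeq c) {g : ℕ → X → ℝ} (hg : ∀ k, (g k).FactorsThrough (c k)) (N : ℕ) :
    (runningMax g N).FactorsThrough (c N) := by
  intro x y hxy
  refine le_antisymm (runningMax_le_iff.2 fun k hk => ?_) (runningMax_le_iff.2 fun k hk => ?_)
  · rw [hc.mono hk (hg k) hxy]; exact le_runningMax g hk y
  · rw [← hc.mono hk (hg k) hxy]; exact le_runningMax g hk x

theorem IsPartitionSeq.factorsThrough_firstExceed [MeasurableSpace X] {c : ℕ → X → I}
    (hc : IsPartitionSeq c) {g : ℕ → X → ℝ} (hg : ∀ k, (g k).FactorsThrough (c k)) (t : ℝ)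
    (m : ℕ) : Function.FactorsThrough (· ∈ firstExceed g t m) (c m) := by
  intro x y hxy
  simp only [firstExceed, Set.mem_ofPred_eq, eq_iff_iff, hg m hxy]
  refine and_congr_right fun _ => forall₂_congr fun i hi => ?_
  rw [hc.mono hi.le (hg i) hxy]

variable [MeasurableSpace X]

/-- Absorption into the left side; it fails for infinite `Y`, which is why all maxima are over
finitely many indices. -/
theorem le_of_le_half_mul_add {Y W : ℝ≥0∞} {a : ℝ} (hY : Y ≠ ∞)
    (h : Y ≤ ENNReal.ofReal (1 / 2) * Y + ENNReal.ofReal a * W) :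
    Y ≤ ENNReal.ofReal (2 * a) * W := by
  have e : Y = ENNReal.ofReal (1 / 2) * Y + ENNReal.ofReal (1 / 2) * Y := by
    rw [← add_mul, ← ENNReal.ofReal_add (by norm_num) (by norm_num)]
    norm_num
  have h1 : ENNReal.ofReal (1 / 2) * Y ≤ ENNReal.ofReal a * W := by
    refine (ENNReal.add_le_add_iff_left (ENNReal.mul_ne_top (ENNReal.ofReal_ne_top (r := 1 / 2)) hY)).1 ?_
    rwa [← e]
  calc Y = ENNReal.ofReal 2 * (ENNReal.ofReal (1 / 2) * Y) := by
        rw [← mul_assoc, ← ENNReal.ofReal_mul zero_le_two]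
        norm_num
    _ ≤ ENNReal.ofReal 2 * (ENNReal.ofReal a * W) := by gcongr
    _ = _ := by rw [← mul_assoc, ← ENNReal.ofReal_mul zero_le_two]

theorem lintegral_rpow_half_eq (μ : Measure X) {f : X → ℝ} (hf : ∀ x, 0 ≤ f x) {p : ℝ} :
    ∫⁻ x, ENNReal.ofReal (f x ^ p) ∂μ
      = ENNReal.ofReal (2 ^ p) * ∫⁻ x, ENNReal.ofReal ((f x / 2) ^ p) ∂μ := by
  rw [← lintegral_const_mul' _ _ ENNReal.ofReal_ne_top]
  refine lintegral_congr fun x => ?_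
  rw [← ENNReal.ofReal_mul (by positivity), ← Real.mul_rpow zero_le_two (by linarith [hf x])]
  congr 2
  ring

/-- Integrated form of a good-`λ` inequality. -/
theorem lintegral_rpow_le_of_goodLambda (μ : Measure X) {f g : X → ℝ} (hf : ∀ x, 0 ≤ f x)
    (hg : ∀ x, 0 ≤ g x) (hfm : Measurable f) (hgm : Measurable g) {p γ κ : ℝ} (hp : 0 < p)
    (hγ : 0 < γ) (hpκ : 2 ^ p * κ ≤ 1 / 2)
    (hfin : ∫⁻ x, ENNReal.ofReal (f x ^ p) ∂μ ≠ ∞)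
    (hgood : ∀ t, 0 < t → μ {x | 2 * t < f x ∧ g x ≤ γ * t} ≤ ENNReal.ofReal κ * μ {x | t < f x}) :
    ∫⁻ x, ENNReal.ofReal (f x ^ p) ∂μ
      ≤ ENNReal.ofReal (2 * (2 / γ) ^ p) * ∫⁻ x, ENNReal.ofReal (g x ^ p) ∂μ := by
  -- Either `g` is small and the good-λ inequality applies, or `g` exceeds `γ * t`.
  have hsub : ∀ t, 0 < t → μ {x | t < f x / 2} ≤
      ENNReal.ofReal κ * μ {x | t < f x} + μ {x | t < g x / γ} := by
    intro t ht
    refine (measure_mono ?_).trans ((measure_union_le {x | 2 * t < f x ∧ g x ≤ γ * t} _).trans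
      (add_le_add_left (hgood t ht) (μ {x | t < g x / γ})))
    intro x hx
    have hx' : 2 * t < f x := by
      have : t < f x / 2 := hx
      linarith
    by_cases hgx : g x ≤ γ * t
    · exact Or.inl ⟨hx', hgx⟩
    · right
      simp only [Set.mem_ofPred_eq, lt_div_iff₀ hγ]
      linarith
  have h1 := lintegral_rpow_eq_lintegral_meas_lt_mul μ
    (Filter.Eventually.of_forall fun x => div_nonneg (hf x) zero_le_two)
    (hfm.div_const 2).aemeasurable hp
  have h2 := lintegral_rpow_eq_lintegral_meas_lt_mul μ (Filter.Eventually.of_forall hf)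
    hfm.aemeasurable hp
  have h3 := lintegral_rpow_eq_lintegral_meas_lt_mul μ
    (Filter.Eventually.of_forall fun x => div_nonneg (hg x) hγ.le)
    (hgm.div_const γ).aemeasurable hp
  have hanti : Measurable fun t : ℝ => μ {x | t < g x / γ} :=
    Antitone.measurable fun s t hst => measure_mono fun x hx => lt_of_le_of_lt hst hx
  have key : ∫⁻ x, ENNReal.ofReal ((f x / 2) ^ p) ∂μ ≤
      ENNReal.ofReal κ * ∫⁻ x, ENNReal.ofReal (f x ^ p) ∂μ
        + ∫⁻ x, ENNReal.ofReal ((g x / γ) ^ p) ∂μ := by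
    rw [h1, h2, h3, mul_left_comm, ← mul_add, ← lintegral_const_mul' (ENNReal.ofReal κ) _ ENNReal.ofReal_ne_top,
      ← lintegral_add_right]
    · gcongr ENNReal.ofReal p * ?_
      refine setLIntegral_mono' measurableSet_Ioi fun t ht => ?_
      calc _ ≤ (ENNReal.ofReal κ * μ {x | t < f x} + μ {x | t < g x / γ})
            * ENNReal.ofReal (t ^ (p - 1)) := by gcongr; exact hsub t ht
        _ = _ := by ring
    · exact hanti.mul (by fun_prop)
  have hgγ : ∫⁻ x, ENNReal.ofReal ((g x / γ) ^ p) ∂μ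
      = ENNReal.ofReal ((1 / γ) ^ p) * ∫⁻ x, ENNReal.ofReal (g x ^ p) ∂μ := by
    rw [← lintegral_const_mul' _ _ ENNReal.ofReal_ne_top]
    refine lintegral_congr fun x => ?_
    rw [← ENNReal.ofReal_mul (by positivity), ← Real.mul_rpow (by positivity) (hg x)]
    congr 2
    ring
  have hhalf := lintegral_rpow_half_eq μ hf (p := p)
  set Y := ∫⁻ x, ENNReal.ofReal (f x ^ p) ∂μ
  set Z := ∫⁻ x, ENNReal.ofReal (g x ^ p) ∂μ
  rw [hgγ] at key
  have h5 : Y ≤ ENNReal.ofReal (1 / 2) * Y + ENNReal.ofReal ((2 / γ) ^ p) * Z := by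
    calc Y ≤ ENNReal.ofReal (2 ^ p) * (ENNReal.ofReal κ * Y + ENNReal.ofReal ((1 / γ) ^ p) * Z) := by
          exact hhalf.le.trans (by gcongr)
      _ = ENNReal.ofReal (2 ^ p * κ) * Y + ENNReal.ofReal ((2 / γ) ^ p) * Z := by
          rw [mul_add, ← mul_assoc, ← mul_assoc, ← ENNReal.ofReal_mul (by positivity),
            ← ENNReal.ofReal_mul (by positivity), ← Real.mul_rpow zero_le_two (by positivity)]
          congr 4
          ring
      _ ≤ _ := by gcongr
  exact le_of_le_half_mul_add hfin h5

/-- A maximal function inequality of weak type, `t μ(f > t) ≤ K ∫_{f > t} |h|`, improves to a strong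
one. -/
theorem lintegral_rpow_le_of_weak (μ : Measure X) {f : X → ℝ} (hf : ∀ x, 0 ≤ f x)
    (hfm : Measurable f) {h : X → ℂ} (hh : AEStronglyMeasurable h μ) {p : ℝ} (hp : 1 < p)
    (hfin : ∫⁻ x, ENNReal.ofReal (f x ^ p) ∂μ ≠ ∞)
    (hweak : ∀ t, 0 < t → ENNReal.ofReal t * μ {x | t < f x} ≤
      μ.withDensity (fun x => ‖h x‖ₑ) {x | t < f x}) :
    ∫⁻ x, ENNReal.ofReal (f x ^ p) ∂μ
      ≤ ENNReal.ofReal ((2 * (p / (p - 1))) ^ p) * ∫⁻ x, ENNReal.ofReal (‖h x‖ ^ p) ∂μ := by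
  -- The layer cake formula for `ν` with exponent `p - 1` replaces an explicit Fubini argument.
  set ν := μ.withDensity fun x => ‖h x‖ₑ
  set q := p / (p - 1) with hq
  have hp1 : 0 < p - 1 := by linarith
  have hq1 : 1 < q := by rw [hq, lt_div_iff₀ hp1]; linarith
  have hνμ : ν ≪ μ := withDensity_absolutelyContinuous _ _
  have h1 := lintegral_rpow_eq_lintegral_meas_lt_mul μ (Filter.Eventually.of_forall hf)
    hfm.aemeasurable (by linarith : 0 < p)
  have h2 := lintegral_rpow_eq_lintegral_meas_lt_mul ν (Filter.Eventually.of_forall hf)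
    hfm.aemeasurable hp1
  have h3 : ∫⁻ x, ENNReal.ofReal (f x ^ p) ∂μ
      ≤ ENNReal.ofReal q * ∫⁻ x, ENNReal.ofReal (f x ^ (p - 1)) ∂ν := by
    rw [h1, h2, ← mul_assoc, ← ENNReal.ofReal_mul (by positivity), hq, div_mul_cancel₀ _ hp1.ne']
    gcongr ENNReal.ofReal p * ?_
    refine setLIntegral_mono' measurableSet_Ioi fun t ht => ?_
    have ht : 0 < t := ht
    calc μ {x | t < f x} * ENNReal.ofReal (t ^ (p - 1))
        = (ENNReal.ofReal t * μ {x | t < f x}) * ENNReal.ofReal (t ^ (p - 1 - 1)) := by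
          rw [Real.rpow_sub_one ht.ne' (p - 1), mul_right_comm, ← ENNReal.ofReal_mul ht.le, mul_comm]
          congr 2
          field_simp
      _ ≤ _ := by gcongr; exact hweak t ht
  have h4 : ENNReal.ofReal q * ∫⁻ x, ENNReal.ofReal (f x ^ (p - 1)) ∂ν ≤
      ENNReal.ofReal (1 / 2) * ∫⁻ x, ENNReal.ofReal (f x ^ p) ∂μ +
        ENNReal.ofReal ((2 * q) ^ p / 2) * ∫⁻ x, ENNReal.ofReal (‖h x‖ ^ p) ∂μ := by
    rw [lintegral_withDensity_eq_lintegral_mul₀ hh.enorm (by fun_prop),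
      ← lintegral_const_mul' _ _ ENNReal.ofReal_ne_top,
      ← lintegral_const_mul' _ _ ENNReal.ofReal_ne_top,
      ← lintegral_const_mul' _ _ ENNReal.ofReal_ne_top, ← lintegral_add_left (by fun_prop)]
    refine lintegral_mono fun x => ?_
    simp only [Pi.mul_apply]
    rw [← ofReal_norm, ← ENNReal.ofReal_mul (norm_nonneg _),
      ← ENNReal.ofReal_mul (by positivity), ← ENNReal.ofReal_mul (by positivity),
      ← ENNReal.ofReal_mul (by positivity), ← ENNReal.ofReal_add
        (mul_nonneg (by norm_num) (Real.rpow_nonneg (hf x) _)) (by positivity)]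
    refine ENNReal.ofReal_le_ofReal ?_
    have hfx := hf x
    have hh0 := norm_nonneg (h x)
    -- A case distinction in place of Young's inequality: q|h|f^(p-1) is at most f^p/2 in the first
    -- case and (2q|h|)^p/2 in the second.
    by_cases hc : 2 * q * ‖h x‖ ≤ f x
    · have e : f x ^ p = f x ^ (p - 1) * f x := by
        rcases hfx.eq_or_lt with h0 | h0
        · rw [← h0, Real.zero_rpow (by linarith), mul_zero]
        · rw [← Real.rpow_add_one h0.ne']; congr 1; ring
      have := mul_le_mul_of_nonneg_left hc (Real.rpow_nonneg hfx (p - 1))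
      have h5 : 0 ≤ (2 * q) ^ p / 2 * ‖h x‖ ^ p := by positivity
      rw [e]
      linarith
    · have hc' := (not_le.1 hc).le
      have h5 : f x ^ (p - 1) ≤ (2 * q * ‖h x‖) ^ (p - 1) :=
        Real.rpow_le_rpow hfx hc' hp1.le
      have hpos : 0 < 2 * q * ‖h x‖ := hfx.trans_lt (not_le.1 hc)
      have e : (2 * q) ^ p * ‖h x‖ ^ p = (2 * q * ‖h x‖) ^ (p - 1) * (2 * q * ‖h x‖) := by
        rw [← Real.mul_rpow (by positivity) hh0, ← Real.rpow_add_one hpos.ne']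
        congr 1; ring
      have h6 := mul_le_mul_of_nonneg_left h5 (by positivity : 0 ≤ q * ‖h x‖)
      have h7 : 0 ≤ f x ^ p := Real.rpow_nonneg hfx _
      linarith
  have h5 := le_of_le_half_mul_add hfin (h3.trans h4)
  rwa [mul_div_cancel₀ _ two_ne_zero] at h5

end RunningMax

/-! ### The `L^p` estimate for nested partitions -/

section MainAbstract

variable {X I : Type} [MeasurableSpace X] {c : ℕ → X → I} {μ : Measure X}

/-- The data of the abstract estimate: on the decreasing sets `α k`, the averages of `b` at level
`k` are bounded above and below. -/
structure IsAccretiveOn (μ : Measure X) (c : ℕ → X → I) (b : X → ℂ) (α : ℕ → Set X) (L : ℝ) :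
    Prop where
  level : ∀ k, Function.FactorsThrough (· ∈ α k) (c k)
  anti : ∀ k, α (k + 1) ⊆ α k
  upper : ∀ k, ∀ x ∈ α k, cellAvg μ (c k) (fun y => ‖b y‖) x ≤ L
  lower : ∀ k, ∀ x ∈ α k, 1 / 2 ≤ ‖cellAvg μ (c k) b x‖

/-- The partial sums of the half-twisted martingale differences. -/
noncomputable def partialSum (μ : Measure X) (c : ℕ → X → I) (h b : X → ℂ) (ε : ℕ → X → ℂ)
    (α : ℕ → Set X) (k : ℕ) (x : X) : ℂ :=
  ∑ i ∈ Finset.range k, quotIncrement μ (c i) (c (i + 1)) h b (ε i) (α (i + 1)) x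

theorem IsPartitionSeq.factorsThrough_partialSum (hc : IsPartitionSeq c) (μ : Measure X)
    (h b : X → ℂ) {ε : ℕ → X → ℂ} (hε : ∀ k, (ε k).FactorsThrough (c k)) {α : ℕ → Set X}
    (hα : ∀ k, Function.FactorsThrough (· ∈ α k) (c k)) (k : ℕ) :
    (partialSum μ c h b ε α k).FactorsThrough (c k) := by
  intro x y hxy
  simp only [partialSum]
  refine Finset.sum_congr rfl fun i hi => ?_
  exact hc.mono (Nat.succ_le_of_lt (Finset.mem_range.1 hi))
    (hc.factorsThrough_quotIncrement μ h b (hε i) (hα (i + 1))) hxy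

/-- Limits the overshoot at the first crossing: where the averages of |h| are small, one step cannot
move the partial sum far. -/
theorem norm_quotIncrement_le {b h : X → ℂ} {α : ℕ → Set X} {L l : ℝ}
    (hα : IsAccretiveOn μ c b α L) {ε : ℕ → X → ℂ} (hε1 : ∀ k x, ‖ε k x‖ ≤ 1) (k : ℕ) (x : X)
    (hl : 0 ≤ l) (h1 : cellAvg μ (c k) (fun y => ‖h y‖) x ≤ l)
    (h2 : cellAvg μ (c (k + 1)) (fun y => ‖h y‖) x ≤ l) :
    ‖quotIncrement μ (c k) (c (k + 1)) h b (ε k) (α (k + 1)) x‖ ≤ 4 * l := by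
  by_cases hx : x ∈ α (k + 1)
  · rw [quotIncrement, Set.indicator_of_mem hx, norm_mul]
    refine (mul_le_of_le_one_left (norm_nonneg _) (hε1 k x)).trans ((norm_sub_le _ _).trans ?_)
    have e1 := norm_div_le_two_mul (a := cellAvg μ (c (k + 1)) h x) (hα.lower (k + 1) x hx)
    have e2 := norm_div_le_two_mul (a := cellAvg μ (c k) h x) (hα.lower k x (hα.anti k hx))
    have e3 := norm_cellAvg_le μ (c k) h x
    have e4 := norm_cellAvg_le μ (c (k + 1)) h x
    simp only [cellQuot]
    linarith
  · rw [quotIncrement, Set.indicator_of_notMem hx, norm_zero]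
    linarith

variable [IsFiniteMeasure μ]

/-- A function constant on cells takes finitely many values; this supplies the finiteness needed for
absorption. -/
theorem IsPartition.lintegral_rpow_ne_top {c : X → I} (hc : IsPartition c) {f : X → ℝ}
    (hf : f.FactorsThrough c) (p : ℝ) : ∫⁻ x, ENNReal.ofReal (f x ^ p) ∂μ ≠ ∞ := by
  have h : Integrable (fun x => f x ^ p) μ := hc.integrable μ fun x y hxy => by simp only [hf hxy]
  refine ne_top_of_le_ne_top h.2.ne (lintegral_mono fun x => ?_)
  exact Real.ofReal_le_enorm _

/-- The martingale maximal function is bounded on `L^p`. -/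
theorem lintegral_runningMax_cellAvg_rpow_le (hc : IsPartitionSeq c) {h : X → ℂ}
    (hh : Integrable h μ) {p : ℝ} (hp : 1 < p) (N : ℕ) :
    ∫⁻ x, ENNReal.ofReal (runningMax (fun k => cellAvg μ (c k) fun y => ‖h y‖) N x ^ p) ∂μ
      ≤ ENNReal.ofReal ((2 * (p / (p - 1))) ^ p) * ∫⁻ x, ENNReal.ofReal (‖h x‖ ^ p) ∂μ := by
  set g : ℕ → X → ℝ := fun k => cellAvg μ (c k) fun y => ‖h y‖ with hg
  have hgl : ∀ k, (g k).FactorsThrough (c k) := fun k => factorsThrough_cellAvg μ (c k) _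
  have hg0 : ∀ k x, 0 ≤ g k x := fun k x => cellAvg_nonneg μ (c k) (fun _ => norm_nonneg _) x
  have hml := hc.factorsThrough_runningMax hgl N
  refine lintegral_rpow_le_of_weak μ (runningMax_nonneg hg0 N) ((hc.part N).measurable hml)
    hh.aestronglyMeasurable hp ((hc.part N).lintegral_rpow_ne_top hml p) fun t ht => ?_
  have hAm : ∀ m, MeasurableSet (firstExceed g t m) := fun m =>
    (hc.part m).measurableSet (hc.factorsThrough_firstExceed hgl t m)
  rw [setOf_lt_runningMax_eq]
  rw [measure_biUnion_finset (fun i _ j _ hij => pairwise_disjoint_firstExceed g t hij)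
      fun m _ => hAm m,
    measure_biUnion_finset (fun i _ j _ hij => pairwise_disjoint_firstExceed g t hij)
      fun m _ => hAm m, Finset.mul_sum]
  refine Finset.sum_le_sum fun m _ => ?_
  rw [withDensity_apply _ (hAm m)]
  -- Doob's argument: the first-crossing set is of level `m`, and there the average of |h| exceeds
  -- `t`.
  have h1 : t * μ.real (firstExceed g t m) ≤ ∫ x in firstExceed g t m, ‖h x‖ ∂μ := by
    rw [← (hc.part m).setIntegral_cellAvg hh.norm (hc.factorsThrough_firstExceed hgl t m)]
    calc t * μ.real (firstExceed g t m) = ∫ x in firstExceed g t m, t ∂μ := by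
          rw [setIntegral_const, smul_eq_mul, mul_comm]
      _ ≤ _ := setIntegral_mono_on (integrable_const _).integrableOn
          ((hc.part m).integrable μ (hgl m)).integrableOn (hAm m) fun x hx => hx.1.le
  calc ENNReal.ofReal t * μ (firstExceed g t m)
      = ENNReal.ofReal (t * μ.real (firstExceed g t m)) := by
        rw [ENNReal.ofReal_mul ht.le, ofReal_measureReal]
    _ ≤ ENNReal.ofReal (∫ x in firstExceed g t m, ‖h x‖ ∂μ) := ENNReal.ofReal_le_ofReal h1
    _ = ∫⁻ x in firstExceed g t m, ‖h x‖ₑ ∂μ := ofReal_integral_norm_eq_lintegral_enorm hh.integrableOn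

/-- Good-`λ` inequality between the maximal partial sums and the martingale maximal function. -/
theorem measureReal_goodLambda_le (hc : IsPartitionSeq c) {h b : X → ℂ}
    (hh : Integrable h μ) (hb : Integrable b μ) {α : ℕ → Set X} {L : ℝ} (hL : 1 ≤ L)
    (hα : IsAccretiveOn μ c b α L) {ε : ℕ → X → ℂ} (hε : ∀ k, (ε k).FactorsThrough (c k))
    (hε1 : ∀ k x, ‖ε k x‖ ≤ 1) (N : ℕ) {t γ : ℝ} (ht : 0 < t) (hγ : 0 < γ) (hγ8 : γ ≤ 1 / 8) :
    μ.real {x | 2 * t < runningMax (fun k x => ‖partialSum μ c h b ε α k x‖) N x ∧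
        runningMax (fun k => cellAvg μ (c k) fun y => ‖h y‖) N x ≤ γ * t}
      ≤ 700 * L ^ 2 * γ *
        μ.real {x | t < runningMax (fun k x => ‖partialSum μ c h b ε α k x‖) N x} := by
  set g : ℕ → X → ℝ := fun k x => ‖partialSum μ c h b ε α k x‖ with hg
  have hSl := hc.factorsThrough_partialSum μ h b hε hα.level
  have hgl : ∀ k, (g k).FactorsThrough (c k) := fun k x y hxy => by simp only [hg, hSl k hxy]
  set M := runningMax (fun k => cellAvg μ (c k) fun y => ‖h y‖) N with hM
  set l := γ * t with hl
  have hl0 : 0 < l := mul_pos hγ ht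
  set E := {x | 2 * t < runningMax g N x ∧ M x ≤ l} with hE
  have hAm : ∀ m, MeasurableSet (firstExceed g t m) := fun m =>
    (hc.part m).measurableSet (hc.factorsThrough_firstExceed hgl t m)
  have hEsub : E ⊆ ⋃ m ∈ Finset.range (N + 1), (E ∩ firstExceed g t m) := by
    rw [← Set.inter_iUnion₂, ← setOf_lt_runningMax_eq]
    intro x hx
    refine ⟨hx, ?_⟩
    have := hx.1
    simp only [Set.mem_ofPred_eq]
    linarith
  have hloc : ∀ m ≤ N, μ.real (E ∩ firstExceed g t m)
      ≤ 700 * L ^ 2 * γ * μ.real (firstExceed g t m) := by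
    intro m hm
    -- The martingale is restarted at level `m` and stopped as soon as the averages of |h| exceed
    -- `l`. Only levels from `m` to `m + k` are inspected, so that `G k` has level `m + k`.
    set G : ℕ → Set X := fun k => {x | x ∈ firstExceed g t m ∧ x ∈ α (m + k) ∧
      ∀ i, m ≤ i → i ≤ m + k → cellAvg μ (c i) (fun y => ‖h y‖) x ≤ l} with hG
    have hGl : ∀ k, Function.FactorsThrough (· ∈ G k) (c (m + k)) := by
      intro k x y hxy
      have e1 : (x ∈ firstExceed g t m) = (y ∈ firstExceed g t m) :=
        hc.mono (Nat.le_add_right m k) (hc.factorsThrough_firstExceed hgl t m) hxy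
      have e2 : (x ∈ α (m + k)) = (y ∈ α (m + k)) := hα.level (m + k) hxy
      simp only [hG, Set.mem_ofPred_eq, e1, e2, eq_iff_iff]
      refine and_congr_right fun _ => and_congr_right fun _ => forall₃_congr fun i _ hi => ?_
      rw [hc.mono hi (factorsThrough_cellAvg μ (c i) _) hxy]
    have hGa : ∀ k, G (k + 1) ⊆ G k := fun k x hx =>
      ⟨hx.1, hα.anti (m + k) hx.2.1, fun i hi hi' => hx.2.2 i hi (hi'.trans (by omega))⟩
    have hw := measureReal_lt_norm_sum_le (c := fun k => c (m + k)) (hc.shift m) hh hb hGl hGa hl0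
      hL (half_pos ht) (fun k x hx => hx.2.2 (m + k) (Nat.le_add_right m k) le_rfl)
      (fun k x hx => hα.upper (m + k) x hx.2.1) (fun k x hx => hα.lower (m + k) x hx.2.1)
      (ε := fun k => ε (m + k)) (fun k => hε (m + k)) (fun k => hε1 (m + k)) N
    have hsub : E ∩ firstExceed g t m ⊆ {x | ∃ k ≤ N, t / 2 < ‖∑ i ∈ Finset.range k,
        quotIncrement μ (c (m + i)) (c (m + (i + 1))) h b (ε (m + i)) (G (i + 1)) x‖} := by
      rintro x ⟨⟨hx1, hx2⟩, hx3, hx4⟩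
      obtain ⟨k, hkN, hk⟩ := lt_runningMax_iff.1 hx1
      have hMx : ∀ i ≤ N, cellAvg μ (c i) (fun y => ‖h y‖) x ≤ l := runningMax_le_iff.1 hx2
      have hmk : m ≤ k := by
        by_contra hlt
        have := hx4 k (not_le.1 hlt)
        linarith
      obtain ⟨r, rfl⟩ := Nat.exists_eq_add_of_le hmk
      refine ⟨r, by omega, ?_⟩
      have e1 : ∑ i ∈ Finset.range r,
          quotIncrement μ (c (m + i)) (c (m + (i + 1))) h b (ε (m + i)) (G (i + 1)) x
          = partialSum μ c h b ε α (m + r) x - partialSum μ c h b ε α m x := by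
        rw [partialSum, partialSum, Finset.sum_range_add, add_sub_cancel_left]
        refine Finset.sum_congr rfl fun i hi => ?_
        have hi := Finset.mem_range.1 hi
        -- On `E` the extra stopping never takes effect, so the restarted sum is the tail of the
        -- original one.
        have hiff : x ∈ G (i + 1) ↔ x ∈ α (m + i + 1) :=
          ⟨fun hx => hx.2.1, fun hx => ⟨⟨hx3, hx4⟩, hx, fun j _ hj => hMx j (by omega)⟩⟩
        by_cases hx : x ∈ α (m + i + 1)
        · rw [quotIncrement, quotIncrement, Set.indicator_of_mem hx,
            Set.indicator_of_mem (hiff.2 hx)]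
          rfl
        · rw [quotIncrement, quotIncrement, Set.indicator_of_notMem hx,
            Set.indicator_of_notMem fun h' => hx (hiff.1 h')]
      -- Since γ ≤ 1/8, this is at most 3t/2, which leaves more than t/2 for the restarted sum to
      -- gain.
      have e2 : ‖partialSum μ c h b ε α m x‖ ≤ t + 4 * l := by
        rcases m with _ | m
        · simp only [partialSum, Finset.range_zero, Finset.sum_empty, norm_zero]
          linarith
        · have h5 := hx4 m (Nat.lt_succ_self m)
          have h6 := norm_quotIncrement_le (h := h) hα hε1 m x hl0.le (hMx m (by omega))
            (hMx (m + 1) hm)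
          rw [partialSum, Finset.sum_range_succ]
          exact (norm_add_le _ _).trans (add_le_add h5 h6)
      rw [e1]
      have e3 := norm_sub_norm_le (partialSum μ c h b ε α (m + r) x) (partialSum μ c h b ε α m x)
      have e4 : 4 * l ≤ t / 2 := by rw [hl]; nlinarith
      have e5 : 2 * t < ‖partialSum μ c h b ε α (m + r) x‖ := hk
      linarith
    have h1 := measureReal_mono (μ := μ) hsub
    have hG0 : μ.real (G 0) ≤ μ.real (firstExceed g t m) := measureReal_mono fun x hx => hx.1
    have h2 : (t / 2) ^ 2 * μ.real (E ∩ firstExceed g t m)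
        ≤ 280 * L ^ 2 * (t / 2 * l + l ^ 2) * μ.real (firstExceed g t m) :=
      (mul_le_mul_of_nonneg_left h1 (by positivity)).trans (hw.trans
        (mul_le_mul_of_nonneg_left hG0 (by positivity)))
    -- 700 = 4 · 280 · (1/2 + 1/8), by γ² ≤ γ/8.
    have h3 : 280 * L ^ 2 * (t / 2 * l + l ^ 2) ≤ (t / 2) ^ 2 * (700 * L ^ 2 * γ) := by
      rw [hl]
      have : γ ^ 2 ≤ γ / 8 := by nlinarith
      have h4 := mul_le_mul_of_nonneg_left this (by positivity : 0 ≤ 280 * L ^ 2 * t ^ 2)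
      linarith
    have h4 := h2.trans (mul_le_mul_of_nonneg_right h3 measureReal_nonneg)
    rw [mul_assoc] at h4
    exact le_of_mul_le_mul_left h4 (by positivity)
  rw [setOf_lt_runningMax_eq, measureReal_biUnion_finset
    (fun i _ j _ hij => pairwise_disjoint_firstExceed g t hij) fun m _ => hAm m, Finset.mul_sum]
  refine (measureReal_mono hEsub (measure_ne_top _ _)).trans ((measureReal_biUnion_finset_le _ _).trans ?_)
  exact Finset.sum_le_sum fun m hm => hloc m (Nat.lt_succ_iff.1 (Finset.mem_range.1 hm))

/-- `L^p` bound for the maximal partial sums of half-twisted martingale differences. -/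
theorem lintegral_runningMax_partialSum_rpow_le (p L : ℝ) (hp : 1 < p) (hL : 1 ≤ L) :
    ∃ C : ℝ≥0, ∀ (X I : Type) [MeasurableSpace X] (c : ℕ → X → I) (μ : Measure X)
      [IsFiniteMeasure μ], IsPartitionSeq c → ∀ h b : X → ℂ, Integrable h μ → Integrable b μ →
      ∀ α : ℕ → Set X, IsAccretiveOn μ c b α L → ∀ ε : ℕ → X → ℂ,
      (∀ k, (ε k).FactorsThrough (c k)) → (∀ k x, ‖ε k x‖ ≤ 1) → ∀ N : ℕ,
      ∫⁻ x, ENNReal.ofReal (runningMax (fun k x => ‖partialSum μ c h b ε α k x‖) N x ^ p) ∂μ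
        ≤ C * ∫⁻ x, ENNReal.ofReal (‖h x‖ ^ p) ∂μ := by
  have h2p : (2 : ℝ) ≤ 2 ^ p := by
    simpa using Real.rpow_le_rpow_of_exponent_le one_le_two hp.le
  have hL2 : 1 ≤ L ^ 2 := by nlinarith
  -- Chosen so that `2 ^ p` times the good-λ factor `700 * L ^ 2 * γ` is exactly 1/2.
  obtain ⟨γ, hγ⟩ : ∃ γ : ℝ, γ = (1400 * L ^ 2 * 2 ^ p)⁻¹ := ⟨_, rfl⟩
  have hγ0 : 0 < γ := by rw [hγ]; positivity
  have hγ8 : γ ≤ 1 / 8 := by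
    rw [hγ, one_div]
    exact inv_anti₀ (by norm_num) (by nlinarith)
  refine ⟨Real.toNNReal (2 * (2 / γ) ^ p) * Real.toNNReal ((2 * (p / (p - 1))) ^ p), ?_⟩
  intro X I _ c μ _ hc h b hh hb α hα ε hε hε1 N
  have hSl := hc.factorsThrough_partialSum μ h b hε hα.level
  have hf := hc.factorsThrough_runningMax (g := fun k x => ‖partialSum μ c h b ε α k x‖)
    (fun k x y hxy => by simp only [hSl k hxy]) N
  have hM := hc.factorsThrough_runningMax (g := fun k => cellAvg μ (c k) fun y => ‖h y‖)
    (fun k => factorsThrough_cellAvg μ (c k) _) N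
  have h1 := lintegral_rpow_le_of_goodLambda μ
    (runningMax_nonneg (g := fun k x => ‖partialSum μ c h b ε α k x‖) (fun _ _ => norm_nonneg _) N)
    (runningMax_nonneg (g := fun k => cellAvg μ (c k) fun y => ‖h y‖)
      (fun k x => cellAvg_nonneg μ (c k) (fun _ => norm_nonneg _) x) N)
    ((hc.part N).measurable hf) ((hc.part N).measurable hM) (κ := 700 * L ^ 2 * γ)
    (by linarith : 0 < p) hγ0
    (by rw [hγ]; apply le_of_eq; field_simp; norm_num)
    ((hc.part N).lintegral_rpow_ne_top hf p)
    (fun t ht => by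
      have h2 := measureReal_goodLambda_le hc hh hb hL hα hε hε1 N ht hγ0 hγ8
      have h3 := ENNReal.ofReal_le_ofReal h2
      rwa [ENNReal.ofReal_mul (by positivity), ofReal_measureReal, ofReal_measureReal] at h3)
  refine h1.trans ?_
  rw [ENNReal.coe_mul, mul_assoc]
  exact mul_le_mul_right (lintegral_runningMax_cellAvg_rpow_le hc hh hp N) _

end MainAbstract

/-! ### The centred maximal function -/

section Maximal

variable {n : ℕ} {μ : Measure (EuclideanSpace ℝ (Fin n))}

theorem HasGrowth.measure_ball_lt_top {m : ℝ} (h : HasGrowth μ m) (x : EuclideanSpace ℝ (Fin n))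
    (r : ℝ) : μ (Metric.ball x r) < ∞ := by
  obtain ⟨C, hC⟩ := h
  rcases le_or_gt r 0 with hr | hr
  · simp [Metric.ball_eq_empty.2 hr]
  · exact (hC x r hr).trans_lt ENNReal.ofReal_lt_top

theorem HasGrowth.isLocallyFiniteMeasure {m : ℝ} (h : HasGrowth μ m) :
    IsLocallyFiniteMeasure μ :=
  ⟨fun x => ⟨Metric.ball x 1, Metric.ball_mem_nhds x one_pos, h.measure_ball_lt_top x 1⟩⟩

/-- Besicovitch covering for sublevel conditions on balls of bounded radius. -/
theorem mul_measure_le_of_besicovitch {N : ℕ} {τ : ℝ} (hτ : 1 < τ)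
    (hN : IsEmpty (Besicovitch.SatelliteConfig (EuclideanSpace ℝ (Fin n)) N τ))
    (F : EuclideanSpace ℝ (Fin n) → ℝ≥0∞) (θ : ℝ≥0∞) (R : ℝ) :
    θ * μ {x | ∃ r, 0 < r ∧ r ≤ R ∧ θ * μ (Metric.ball x r) ≤ ∫⁻ y in Metric.ball x r, F y ∂μ}
      ≤ N * ∫⁻ y, F y ∂μ := by
  set E := {x | ∃ r, 0 < r ∧ r ≤ R ∧ θ * μ (Metric.ball x r) ≤ ∫⁻ y in Metric.ball x r, F y ∂μ}
    with hE
  choose r hr0 hrR hr using fun x : E => x.2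
  let q : Besicovitch.BallPackage E (EuclideanSpace ℝ (Fin n)) :=
    { c := fun x => x
      r := r
      rpos := hr0
      r_bound := R
      r_le := hrR }
  obtain ⟨s, hs, hcov⟩ := Besicovitch.exist_disjoint_covering_families hτ hN q
  -- The covering theorem makes the closed balls disjoint within each family while the open balls
  -- already cover the centres, so open balls suffice throughout.
  have hdisj : ∀ i, (s i).PairwiseDisjoint fun j : E =>
      Metric.ball (j : EuclideanSpace ℝ (Fin n)) (r j) := fun i =>
    (hs i).mono fun j => Metric.ball_subset_closedBall
  have hcount : ∀ i, (s i).Countable := fun i =>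
    (hdisj i).countable_of_isOpen (fun _ _ => Metric.isOpen_ball)
      fun j _ => Metric.nonempty_ball.2 (hr0 j)
  have hEsub : E ⊆ ⋃ i : Fin N, ⋃ j ∈ s i, Metric.ball (j : EuclideanSpace ℝ (Fin n)) (r j) := by
    intro x hx
    exact hcov ⟨⟨x, hx⟩, rfl⟩
  have hone : ∀ i, θ * μ (⋃ j ∈ s i, Metric.ball (j : EuclideanSpace ℝ (Fin n)) (r j))
      ≤ ∫⁻ y, F y ∂μ := by
    intro i
    calc θ * μ (⋃ j ∈ s i, Metric.ball (j : EuclideanSpace ℝ (Fin n)) (r j))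
        ≤ θ * ∑' j : s i, μ (Metric.ball (j : EuclideanSpace ℝ (Fin n)) (r j)) := by
          gcongr
          exact measure_biUnion_le μ (hcount i) _
      _ = ∑' j : s i, θ * μ (Metric.ball (j : EuclideanSpace ℝ (Fin n)) (r j)) :=
          ENNReal.tsum_mul_left.symm
      _ ≤ ∑' j : s i, ∫⁻ y in Metric.ball (j : EuclideanSpace ℝ (Fin n)) (r j), F y ∂μ :=
          ENNReal.tsum_le_tsum fun j => hr j
      _ = ∫⁻ y in ⋃ j ∈ s i, Metric.ball (j : EuclideanSpace ℝ (Fin n)) (r j), F y ∂μ :=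
          (lintegral_biUnion (hcount i) (fun _ _ => Metric.isOpen_ball.measurableSet)
            (hdisj i) F).symm
      _ ≤ ∫⁻ y, F y ∂μ := setLIntegral_le_lintegral _ _
  calc θ * μ E
      ≤ θ * ∑ i : Fin N, μ (⋃ j ∈ s i, Metric.ball (j : EuclideanSpace ℝ (Fin n)) (r j)) := by
        gcongr
        exact (measure_mono hEsub).trans (measure_iUnion_fintype_le μ _)
    _ = ∑ i : Fin N, θ * μ (⋃ j ∈ s i, Metric.ball (j : EuclideanSpace ℝ (Fin n)) (r j)) :=
        Finset.mul_sum _ _ _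
    _ ≤ ∑ _i : Fin N, ∫⁻ y, F y ∂μ := Finset.sum_le_sum fun i _ => hone i
    _ = N * ∫⁻ y, F y ∂μ := by simp

/-- Weak type estimate for the centred maximal function, in terms of the large part of `h`. -/
theorem mul_measure_lt_centredMaximal_le {N : ℕ} {τ : ℝ} (hτ : 1 < τ)
    (hN : IsEmpty (Besicovitch.SatelliteConfig (EuclideanSpace ℝ (Fin n)) N τ))
    (hfin : ∀ x r, μ (Metric.ball x r) < ∞) (h : EuclideanSpace ℝ (Fin n) → ℂ) {t : ℝ}
    (ht : 0 < t) :
    ENNReal.ofReal (t / 2) * μ {x | ENNReal.ofReal t < centredMaximal μ h x}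
      ≤ N * μ.withDensity (fun y => ‖h y‖ₑ) {y | t < 2 * ‖h y‖} := by
  -- The part of `h` of size at most t/2 contributes at most t/2 to any average, so the rest must
  -- account for the other half.
  set F : EuclideanSpace ℝ (Fin n) → ℝ≥0∞ := {y | t < 2 * ‖h y‖}.indicator fun y => ‖h y‖ₑ
  set θ := ENNReal.ofReal (t / 2) with hθ
  have hθ2 : ENNReal.ofReal t = θ + θ := by
    rw [hθ, ← ENNReal.ofReal_add (by positivity) (by positivity)]
    congr 1
    ring
  -- Besicovitch needs bounded radii; the bound is removed by exhausting with an increasing union.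
  set E : ℕ → Set (EuclideanSpace ℝ (Fin n)) := fun k => {x | ∃ r, 0 < r ∧ r ≤ (k : ℝ) ∧
    θ * μ (Metric.ball x r) ≤ ∫⁻ y in Metric.ball x r, F y ∂μ} with hE
  have hmono : Monotone E := fun i j hij x ⟨r, h0, h1, h2⟩ =>
    ⟨r, h0, h1.trans (Nat.cast_le.2 hij), h2⟩
  have hsub : {x | ENNReal.ofReal t < centredMaximal μ h x} ⊆ ⋃ k, E k := by
    intro x hx
    have hx : ENNReal.ofReal t < centredMaximal μ h x := hx
    simp only [centredMaximal, lt_iSup_iff] at hx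
    obtain ⟨r, hr0, hr⟩ := hx
    obtain ⟨k, hk⟩ := exists_nat_ge r
    refine Set.mem_iUnion.2 ⟨k, r, hr0, hk, ?_⟩
    rw [setLAverage_eq] at hr
    have h1 := ENNReal.mul_lt_of_lt_div hr
    have h2 : ∫⁻ y in Metric.ball x r, ‖h y‖ₑ ∂μ
        ≤ ∫⁻ y in Metric.ball x r, F y ∂μ + θ * μ (Metric.ball x r) := by
      rw [← setLIntegral_const, ← lintegral_add_right _ measurable_const]
      refine lintegral_mono fun y => ?_
      by_cases hy : t < 2 * ‖h y‖
      · exact le_add_right (by simp [F, hy])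
      · refine le_add_left ?_
        rw [← ofReal_norm, hθ]
        exact ENNReal.ofReal_le_ofReal (by linarith)
    rw [hθ2, add_mul] at h1
    exact (ENNReal.add_le_add_iff_right
      (ENNReal.mul_ne_top ENNReal.ofReal_ne_top (hfin x r).ne)).1 (h1.le.trans h2)
  calc θ * μ {x | ENNReal.ofReal t < centredMaximal μ h x} ≤ θ * μ (⋃ k, E k) := by gcongr
    _ = ⨆ k, θ * μ (E k) := by rw [hmono.measure_iUnion, ENNReal.mul_iSup]
    _ ≤ N * ∫⁻ y, F y ∂μ := iSup_le fun k => mul_measure_le_of_besicovitch hτ hN F θ k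
    _ ≤ _ := by
        gcongr
        exact (lintegral_indicator_le _ _).trans (withDensity_apply_le _ _)

theorem lintegral_centredMaximal_sq_le {N : ℕ} {τ : ℝ} (hτ : 1 < τ)
    (hN : IsEmpty (Besicovitch.SatelliteConfig (EuclideanSpace ℝ (Fin n)) N τ))
    (hfin : ∀ x r, μ (Metric.ball x r) < ∞) {h : EuclideanSpace ℝ (Fin n) → ℂ}
    (hh : AEStronglyMeasurable h μ) :
    ∫⁻ x, centredMaximal μ h x ^ 2 ∂μ ≤ 8 * N * ∫⁻ x, ‖h x‖ₑ ^ 2 ∂μ := by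
  set ν := μ.withDensity fun y => ‖h y‖ₑ with hν
  have hνh : ∫⁻ t in Set.Ioi (0 : ℝ), ν {y | t < 2 * ‖h y‖} = 2 * ∫⁻ x, ‖h x‖ₑ ^ 2 ∂μ := by
    have hm : AEMeasurable (fun y => 2 * ‖h y‖) ν :=
      (hh.norm.aemeasurable.const_mul 2).mono_ac (withDensity_absolutelyContinuous _ _)
    rw [← lintegral_eq_lintegral_meas_lt ν (Filter.Eventually.of_forall fun y => by positivity) hm,
      hν, lintegral_withDensity_eq_lintegral_mul₀ hh.enorm (by fun_prop),
      ← lintegral_const_mul' _ _ (by simp)]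
    refine lintegral_congr fun x => ?_
    simp only [Pi.mul_apply]
    rw [ENNReal.ofReal_mul zero_le_two, ofReal_norm, ENNReal.ofReal_ofNat]
    ring
  rw [lintegral_eq_nnreal]
  -- Passing to simple functions below the integrand avoids proving that the maximal function is
  -- measurable.
  refine iSup₂_le fun φ hφ => ?_
  have hφm : Measurable fun x => Real.sqrt (φ x) := by fun_prop
  have hφ2 : (φ.map ((↑) : ℝ≥0 → ℝ≥0∞)).lintegral μ
      = ∫⁻ x, ENNReal.ofReal (Real.sqrt (φ x) ^ (2 : ℝ)) ∂μ := by
    rw [← SimpleFunc.lintegral_eq_lintegral]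
    refine lintegral_congr fun x => ?_
    rw [Real.rpow_two, Real.sq_sqrt (NNReal.coe_nonneg _), SimpleFunc.map_apply, ENNReal.ofReal_coe_nnreal]
  have hsub : ∀ t : ℝ, 0 < t → {x | t < Real.sqrt (φ x)} ⊆
      {x | ENNReal.ofReal t < centredMaximal μ h x} := by
    intro t ht x hx
    have hx : t < Real.sqrt (φ x) := hx
    have h1 : t ^ 2 < φ x := (Real.lt_sqrt ht.le).1 hx
    have h2 : ENNReal.ofReal t ^ 2 < centredMaximal μ h x ^ 2 := by
      refine lt_of_lt_of_le ?_ (hφ x)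
      rw [← ENNReal.ofReal_pow ht.le, ← ENNReal.ofReal_coe_nnreal]
      exact (ENNReal.ofReal_lt_ofReal_iff_of_nonneg (sq_nonneg t)).2 h1
    exact not_le.1 fun hle => absurd (pow_le_pow_left' hle 2) (not_le.2 h2)
  rw [hφ2, lintegral_rpow_eq_lintegral_meas_lt_mul μ
    (Filter.Eventually.of_forall fun x => Real.sqrt_nonneg _) hφm.aemeasurable two_pos]
  calc ENNReal.ofReal 2 * ∫⁻ t in Set.Ioi (0 : ℝ),
        μ {x | t < Real.sqrt (φ x)} * ENNReal.ofReal (t ^ ((2 : ℝ) - 1))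
      ≤ ENNReal.ofReal 2 * ∫⁻ t in Set.Ioi (0 : ℝ), 2 * N * ν {y | t < 2 * ‖h y‖} := by
        gcongr ENNReal.ofReal 2 * ?_
        refine setLIntegral_mono' measurableSet_Ioi fun t ht => ?_
        have ht : 0 < t := ht
        have e : ENNReal.ofReal (t ^ ((2 : ℝ) - 1)) = 2 * ENNReal.ofReal (t / 2) := by
          rw [← ENNReal.ofReal_ofNat 2, ← ENNReal.ofReal_mul zero_le_two,
            show (2 : ℝ) - 1 = 1 by norm_num, Real.rpow_one, mul_div_cancel₀ _ two_ne_zero]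
        rw [e, mul_comm, mul_assoc, mul_assoc]
        gcongr 2 * ?_
        exact le_trans (mul_le_mul_right (measure_mono (hsub t ht)) _)
          (mul_measure_lt_centredMaximal_le hτ hN hfin h ht)
    _ = 8 * N * ∫⁻ x, ‖h x‖ₑ ^ 2 ∂μ := by
        rw [lintegral_const_mul' _ _ (by finiteness), hνh, ENNReal.ofReal_ofNat]
        ring

theorem eLpNorm_two_sq {E X : Type} [MeasurableSpace X] [TopologicalSpace E]
    [ContinuousENorm E] (μ : Measure X) (f : X → E) :
    eLpNorm f 2 μ ^ 2 = ∫⁻ x, ‖f x‖ₑ ^ 2 ∂μ := by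
  rw [eLpNorm_eq_lintegral_rpow_enorm_toReal two_ne_zero ENNReal.ofNat_ne_top, ← ENNReal.rpow_natCast,
    ← ENNReal.rpow_mul]
  simp

/-- The centred maximal operator is bounded on `L²` with a constant that depends only on the
dimension. -/
theorem exists_centredMaximalNorm_le (n : ℕ) :
    ∃ K : ℝ≥0, ∀ μ : Measure (EuclideanSpace ℝ (Fin n)),
      (∀ x r, μ (Metric.ball x r) < ∞) → centredMaximalNorm μ ≤ K := by
  obtain ⟨N, τ, hτ, hN⟩ :=
    HasBesicovitchCovering.no_satelliteConfig (α := EuclideanSpace ℝ (Fin n))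
  -- A crude substitute for the square root of `8 * N`.
  refine ⟨8 * N + 1, fun μ hfin => sInf_le fun h hh => ?_⟩
  have h1 := lintegral_centredMaximal_sq_le hτ hN hfin hh.1
  refine (ENNReal.pow_le_pow_left_iff two_ne_zero).1 ?_
  rw [mul_pow, eLpNorm_two_sq, eLpNorm_two_sq]
  simp only [enorm_eq_self]
  refine h1.trans ?_
  gcongr
  push_cast
  calc (8 * N : ℝ≥0∞) ≤ 8 * N + 1 := le_self_add
    _ ≤ (8 * N + 1) ^ 2 := le_self_pow₀ (by simp) two_ne_zero

theorem eLpNorm_centredMaximal_le (hμ : centredMaximalNorm μ ≠ ∞)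
    {h : EuclideanSpace ℝ (Fin n) → ℂ} (hh : MemLp h 2 μ) :
    eLpNorm (centredMaximal μ h) 2 μ ≤ centredMaximalNorm μ * eLpNorm h 2 μ := by
  by_cases h0 : eLpNorm h 2 μ = 0
  · rw [h0, mul_zero]
    obtain ⟨C, hC⟩ : {C : ℝ≥0∞ | ∀ h : EuclideanSpace ℝ (Fin n) → ℂ, MemLp h 2 μ →
      eLpNorm (centredMaximal μ h) 2 μ ≤ C * eLpNorm h 2 μ}.Nonempty := by
      by_contra hne
      rw [Set.not_nonempty_iff_eq_empty] at hne
      exact hμ (by rw [centredMaximalNorm, hne, sInf_empty])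
    simpa [h0] using hC h hh
  · rw [← ENNReal.div_le_iff h0 hh.2.ne]
    exact le_sInf fun C hC => (ENNReal.div_le_iff h0 hh.2.ne).2 (hC h hh)

/-- Differentiation in the Besicovitch Vitali family uses closed balls, the maximal function open
ones. A closed ball is the limit of slightly larger open balls, even when spheres carry mass. -/
theorem setLIntegral_closedBall_le (hfin : ∀ x r, μ (Metric.ball x r) < ∞)
    (h : EuclideanSpace ℝ (Fin n) → ℂ) (x : EuclideanSpace ℝ (Fin n)) {r : ℝ} (hr : 0 < r) :
    (∫⁻ y in Metric.closedBall x r, ‖h y‖ₑ ∂μ) / μ (Metric.closedBall x r)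
      ≤ centredMaximal μ h x := by
  rcases eq_or_ne (centredMaximal μ h x) ∞ with htop | htop
  · rw [htop]; exact le_top
  refine ENNReal.div_le_of_le_mul ?_
  set s : ℕ → Set (EuclideanSpace ℝ (Fin n)) := fun k => Metric.ball x (r + 1 / ((k : ℝ) + 1))
    with hs
  have hpos : ∀ k : ℕ, 0 < 1 / ((k : ℝ) + 1) := fun k => by positivity
  have hlim : Filter.Tendsto (fun k : ℕ => r + 1 / ((k : ℝ) + 1)) Filter.atTop (nhds r) := by
    simpa using tendsto_one_div_add_atTop_nhds_zero_nat.const_add r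
  have hInter : ⋂ k, s k = Metric.closedBall x r := by
    ext y
    simp only [hs, Set.mem_iInter, Metric.mem_ball, Metric.mem_closedBall]
    constructor
    · exact fun hy => ge_of_tendsto' hlim fun k => (hy k).le
    · exact fun hy k => hy.trans_lt (by linarith [hpos k])
  have hanti : Antitone s := fun i j hij => Metric.ball_subset_ball (by
    have := one_div_le_one_div_of_le (by positivity : (0 : ℝ) < (i : ℝ) + 1)
      (by gcongr : (i : ℝ) + 1 ≤ (j : ℝ) + 1)
    linarith)
  have ht := tendsto_measure_iInter_atTop (μ := μ) (s := s)
    (fun k => Metric.isOpen_ball.nullMeasurableSet) hanti ⟨0, (hfin _ _).ne⟩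
  rw [hInter] at ht
  refine ge_of_tendsto' (ENNReal.Tendsto.const_mul ht (Or.inr htop)) fun k => ?_
  have h1 : ⨍⁻ y in s k, ‖h y‖ₑ ∂μ ≤ centredMaximal μ h x :=
    le_iSup₂_of_le (r + 1 / ((k : ℝ) + 1)) (by linarith [hpos k]) le_rfl
  have h2 := measure_mul_setLAverage (μ := μ) (fun y => ‖h y‖ₑ) (hfin x (r + 1 / ((k : ℝ) + 1))).ne
  calc ∫⁻ y in Metric.closedBall x r, ‖h y‖ₑ ∂μ
      ≤ ∫⁻ y in s k, ‖h y‖ₑ ∂μ := by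
        refine lintegral_mono_set ?_
        rw [← hInter]
        exact Set.iInter_subset _ k
    _ = μ (s k) * ⨍⁻ y in s k, ‖h y‖ₑ ∂μ := h2.symm
    _ ≤ centredMaximal μ h x * μ (s k) := by rw [mul_comm]; gcongr

theorem ae_enorm_le_centredMaximal [IsLocallyFiniteMeasure μ]
    (hfin : ∀ x r, μ (Metric.ball x r) < ∞) {h : EuclideanSpace ℝ (Fin n) → ℂ}
    (hh : Integrable h μ) : ∀ᵐ x ∂μ, ‖h x‖ₑ ≤ centredMaximal μ h x := by
  filter_upwards [(Besicovitch.vitaliFamily μ).ae_tendsto_lintegral_div hh.1.enorm hh.2.ne] with x hx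
  have h1 := hx.comp (Besicovitch.tendsto_filterAt μ x)
  refine le_of_tendsto h1 ?_
  filter_upwards [self_mem_nhdsWithin] with r hr
  exact setLIntegral_closedBall_le hfin h x hr

end Maximal

/-! ### Combinatorics of dyadic cubes -/

namespace Cube

variable {n : ℕ}

theorem corner_mem (Q : Cube n) : Q.corner ∈ Q.toSet := fun i =>
  ⟨le_rfl, by linarith [Q.side_pos]⟩

theorem measurableSet_toSet (Q : Cube n) : MeasurableSet Q.toSet := by
  have : Q.toSet = ⋂ i, {x | Q.corner i ≤ x i ∧ x i < Q.corner i + Q.side} := by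
    ext x; simp [toSet]
  rw [this]
  refine MeasurableSet.iInter fun i => ?_
  have hm : Measurable fun x : EuclideanSpace ℝ (Fin n) => x i := by fun_prop
  exact (measurableSet_le measurable_const hm).inter (measurableSet_lt hm measurable_const)

/-- This is where `1 ≤ n` enters: in dimension zero all cubes are the same point set, whatever their
side. -/
theorem toSet_injective (hn : 1 ≤ n) : Function.Injective (toSet : Cube n → Set _) := by
  have side_le : ∀ Q P : Cube n, Q.corner = P.corner → Q.toSet ⊆ P.toSet → Q.side ≤ P.side := by
    intro Q P hc hQP
    by_contra! hlt
    have hx : WithLp.toLp 2 (fun i => Q.corner i + P.side) ∈ Q.toSet := fun i => by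
      simp only
      exact ⟨by linarith [P.side_pos], by linarith⟩
    have := (hQP hx ⟨0, hn⟩).2
    simp only [hc] at this
    exact lt_irrefl _ this
  intro Q P h
  have hc : Q.corner = P.corner := by
    ext i
    exact le_antisymm ((h ▸ P.corner_mem : P.corner ∈ Q.toSet) i).1
      ((h ▸ Q.corner_mem : Q.corner ∈ P.toSet) i).1
  exact Cube.ext hc (le_antisymm (side_le Q P hc h.subset) (side_le P Q hc.symm h.symm.subset))

theorem child_subset (Q : Cube n) (σ : Fin n → Fin 2) : (Q.child σ).toSet ⊆ Q.toSet := by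
  intro x hx i
  have h1 := hx i
  simp only [child] at h1
  have h2 : ((σ i : ℕ) : ℝ) ≤ 1 := by exact_mod_cast Nat.lt_succ_iff.1 (σ i).2
  have h3 : (0 : ℝ) ≤ ((σ i : ℕ) : ℝ) := Nat.cast_nonneg _
  have h4 := Q.side_pos
  constructor <;> nlinarith [h1.1, h1.2]

theorem exists_mem_child {Q : Cube n} {x : EuclideanSpace ℝ (Fin n)} (hx : x ∈ Q.toSet) :
    ∃ σ, x ∈ (Q.child σ).toSet := by
  classical
  refine ⟨fun i => if x i < Q.corner i + Q.side / 2 then 0 else 1, fun i => ?_⟩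
  have h1 := hx i
  simp only [child]
  split_ifs with h
  · simpa using ⟨h1.1, h⟩
  · simp only [Fin.isValue, Fin.val_one, Nat.cast_one, one_mul]
    exact ⟨not_lt.1 h, by linarith [h1.2]⟩

theorem eq_of_mem_child {Q : Cube n} {σ τ : Fin n → Fin 2} {x : EuclideanSpace ℝ (Fin n)}
    (hσ : x ∈ (Q.child σ).toSet) (hτ : x ∈ (Q.child τ).toSet) : σ = τ := by
  funext i
  have h1 := hσ i
  have h2 := hτ i
  simp only [child] at h1 h2
  have h4 := Q.side_pos
  generalize σ i = a at *
  generalize τ i = b at *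
  fin_cases a <;> fin_cases b <;> simp at h1 h2 ⊢ <;> linarith

theorem subset_of_mem_dyadicGen {Q₀ Q : Cube n} {k : ℕ} (hQ : Q ∈ dyadicGen Q₀ k) :
    Q.toSet ⊆ Q₀.toSet := by
  induction k generalizing Q with
  | zero => rw [show Q = Q₀ from hQ]
  | succ k ih =>
    simp only [dyadicGen, Set.mem_iUnion] at hQ
    obtain ⟨P, hP, σ, rfl⟩ := hQ
    exact (child_subset P σ).trans (ih hP)

theorem child_mem_dyadicGen {Q₀ Q : Cube n} {k : ℕ} (hQ : Q ∈ dyadicGen Q₀ k)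
    (σ : Fin n → Fin 2) : Q.child σ ∈ dyadicGen Q₀ (k + 1) := by
  simp only [dyadicGen, Set.mem_iUnion]
  exact ⟨Q, hQ, σ, rfl⟩

theorem exists_mem_dyadicGen {Q₀ : Cube n} {x : EuclideanSpace ℝ (Fin n)} (hx : x ∈ Q₀.toSet)
    (k : ℕ) : ∃ Q ∈ dyadicGen Q₀ k, x ∈ Q.toSet := by
  induction k with
  | zero => exact ⟨Q₀, rfl, hx⟩
  | succ k ih =>
    obtain ⟨Q, hQ, hxQ⟩ := ih
    obtain ⟨σ, hσ⟩ := exists_mem_child hxQ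
    exact ⟨Q.child σ, child_mem_dyadicGen hQ σ, hσ⟩

theorem eq_of_mem_dyadicGen {Q₀ Q P : Cube n} {k : ℕ} (hQ : Q ∈ dyadicGen Q₀ k)
    (hP : P ∈ dyadicGen Q₀ k) {x : EuclideanSpace ℝ (Fin n)} (hxQ : x ∈ Q.toSet)
    (hxP : x ∈ P.toSet) : Q = P := by
  induction k generalizing Q P with
  | zero => rw [show Q = Q₀ from hQ, show P = Q₀ from hP]
  | succ k ih =>
    simp only [dyadicGen, Set.mem_iUnion] at hQ hP
    obtain ⟨Q', hQ', σ, rfl⟩ := hQ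
    obtain ⟨P', hP', τ, rfl⟩ := hP
    obtain rfl := ih hQ' hP' (child_subset _ _ hxQ) (child_subset _ _ hxP)
    rw [eq_of_mem_child hxQ hxP]

theorem mem_dyadicGen_add {Q₀ P Q : Cube n} {j k : ℕ} (hP : P ∈ dyadicGen Q₀ j)
    (hQ : Q ∈ dyadicGen P k) : Q ∈ dyadicGen Q₀ (j + k) := by
  induction k generalizing Q with
  | zero => rwa [show Q = P from hQ]
  | succ k ih =>
    simp only [dyadicGen, Set.mem_iUnion] at hQ
    obtain ⟨R, hR, σ, rfl⟩ := hQ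
    exact child_mem_dyadicGen (ih hR) σ

theorem exists_of_mem_dyadicGen_add {Q₀ Q : Cube n} {j k : ℕ} (hQ : Q ∈ dyadicGen Q₀ (j + k)) :
    ∃ P ∈ dyadicGen Q₀ j, Q ∈ dyadicGen P k := by
  induction k generalizing Q with
  | zero => exact ⟨Q, hQ, rfl⟩
  | succ k ih =>
    rw [← add_assoc] at hQ
    simp only [dyadicGen, Set.mem_iUnion] at hQ
    obtain ⟨R, hR, σ, rfl⟩ := hQ
    obtain ⟨P, hP, hRP⟩ := ih hR
    exact ⟨P, hP, child_mem_dyadicGen hRP σ⟩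

/-- Intersecting cubes of the grid are nested. -/
theorem mem_dyadicGen_sub {Q₀ P Q : Cube n} {j k : ℕ} (hP : P ∈ dyadicGen Q₀ j)
    (hQ : Q ∈ dyadicGen Q₀ k) (hjk : j ≤ k) {x : EuclideanSpace ℝ (Fin n)} (hxP : x ∈ P.toSet)
    (hxQ : x ∈ Q.toSet) : Q ∈ dyadicGen P (k - j) := by
  obtain ⟨i, rfl⟩ := Nat.exists_eq_add_of_le hjk
  obtain ⟨R, hR, hQR⟩ := exists_of_mem_dyadicGen_add hQ
  rw [eq_of_mem_dyadicGen hP hR hxP (subset_of_mem_dyadicGen hQR hxQ), Nat.add_sub_cancel_left]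
  exact hQR

theorem subset_of_le {Q₀ P Q : Cube n} {j k : ℕ} (hP : P ∈ dyadicGen Q₀ j)
    (hQ : Q ∈ dyadicGen Q₀ k) (hjk : j ≤ k) {x : EuclideanSpace ℝ (Fin n)} (hxP : x ∈ P.toSet)
    (hxQ : x ∈ Q.toSet) : Q.toSet ⊆ P.toSet :=
  subset_of_mem_dyadicGen (mem_dyadicGen_sub hP hQ hjk hxP hxQ)

theorem mem_dyadic_iff {Q₀ Q : Cube n} : Q ∈ Q₀.dyadic ↔ ∃ k, Q ∈ dyadicGen Q₀ k :=
  Set.mem_iUnion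

theorem subset_of_mem_dyadic {Q₀ Q : Cube n} (hQ : Q ∈ Q₀.dyadic) : Q.toSet ⊆ Q₀.toSet := by
  obtain ⟨k, hk⟩ := mem_dyadic_iff.1 hQ
  exact subset_of_mem_dyadicGen hk

theorem subset_or_subset {Q₀ P Q : Cube n} (hP : P ∈ Q₀.dyadic) (hQ : Q ∈ Q₀.dyadic)
    {x : EuclideanSpace ℝ (Fin n)} (hxP : x ∈ P.toSet) (hxQ : x ∈ Q.toSet) :
    P.toSet ⊆ Q.toSet ∨ Q.toSet ⊆ P.toSet := by
  obtain ⟨j, hj⟩ := mem_dyadic_iff.1 hP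
  obtain ⟨k, hk⟩ := mem_dyadic_iff.1 hQ
  rcases le_total j k with h | h
  · exact Or.inr (subset_of_le hj hk h hxP hxQ)
  · exact Or.inl (subset_of_le hk hj h hxQ hxP)

theorem mem_dyadic_of_mem {Q₀ P Q : Cube n} (hP : P ∈ Q₀.dyadic) (hQ : Q ∈ P.dyadic) :
    Q ∈ Q₀.dyadic := by
  obtain ⟨j, hj⟩ := mem_dyadic_iff.1 hP
  obtain ⟨k, hk⟩ := mem_dyadic_iff.1 hQ
  exact mem_dyadic_iff.2 ⟨_, mem_dyadicGen_add hj hk⟩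

theorem child_mem_dyadic {Q₀ Q : Cube n} (hQ : Q ∈ Q₀.dyadic) (σ : Fin n → Fin 2) :
    Q.child σ ∈ Q₀.dyadic := by
  obtain ⟨k, hk⟩ := mem_dyadic_iff.1 hQ
  exact mem_dyadic_iff.2 ⟨_, child_mem_dyadicGen hk σ⟩

theorem mem_dyadic_of_subset (hn : 1 ≤ n) {Q₀ P Q : Cube n} (hP : P ∈ Q₀.dyadic)
    (hQ : Q ∈ Q₀.dyadic) (hQP : Q.toSet ⊆ P.toSet) : Q ∈ P.dyadic := by
  obtain ⟨j, hj⟩ := mem_dyadic_iff.1 hP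
  obtain ⟨k, hk⟩ := mem_dyadic_iff.1 hQ
  rcases le_total j k with h | h
  · exact mem_dyadic_iff.2 ⟨_, mem_dyadicGen_sub hj hk h (hQP Q.corner_mem) Q.corner_mem⟩
  · have h1 := subset_of_le hk hj h Q.corner_mem (hQP Q.corner_mem)
    rw [toSet_injective hn (hQP.antisymm h1)]
    exact mem_dyadic_iff.2 ⟨0, rfl⟩

/-- A cube of the grid that strictly contains a child contains the parent. -/
theorem subset_of_child_subset (hn : 1 ≤ n) {Q₀ Q S : Cube n} (hQ : Q ∈ Q₀.dyadic)
    (hS : S ∈ Q₀.dyadic) {σ : Fin n → Fin 2} (h : (Q.child σ).toSet ⊆ S.toSet)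
    (hne : S ≠ Q.child σ) : Q.toSet ⊆ S.toSet := by
  obtain ⟨q, hq⟩ := mem_dyadic_iff.1 hQ
  obtain ⟨s, hs⟩ := mem_dyadic_iff.1 hS
  have hc := (Q.child σ).corner_mem
  rcases le_or_gt s q with hsq | hsq
  · exact subset_of_le hs hq hsq (h hc) (child_subset _ _ hc)
  · have h1 := subset_of_le (child_mem_dyadicGen hq σ) hs hsq hc (h hc)
    exact absurd (toSet_injective hn (h1.antisymm h)) hne

end Cube

/-! ### Combinatorics of stopping cubes -/

section Stopping

variable {n : ℕ} {μ : Measure (EuclideanSpace ℝ (Fin n))} {T : Lp ℂ 2 μ →L[ℂ] Lp ℂ 2 μ}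
  {b : Cube n → Lp ℂ 2 μ} {A B : ℝ} {Qstar : Cube n}

theorem mem_dyadic_of_mem_stopGen {j : ℕ} {F : Cube n} (hF : F ∈ stopGen μ T b A B Qstar j) :
    F ∈ Qstar.dyadic := by
  cases j with
  | zero => exact Cube.mem_dyadic_iff.2 ⟨0, hF⟩
  | succ j =>
    simp only [stopGen, Set.mem_iUnion] at hF
    obtain ⟨G, -, hG⟩ := hF
    exact hG.1

theorem mem_stopCubes_iff {F : Cube n} :
    F ∈ stopCubes μ T b A B Qstar ↔ ∃ j, F ∈ stopGen μ T b A B Qstar j :=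
  Set.mem_iUnion

theorem mem_dyadic_of_mem_stopCubes {F : Cube n} (hF : F ∈ stopCubes μ T b A B Qstar) :
    F ∈ Qstar.dyadic := by
  obtain ⟨j, hj⟩ := mem_stopCubes_iff.1 hF
  exact mem_dyadic_of_mem_stopGen hj

theorem exists_stopChildren_of_mem_stopGen {i j : ℕ} (hij : i < j) {F : Cube n}
    (hF : F ∈ stopGen μ T b A B Qstar j) : ∃ G ∈ stopGen μ T b A B Qstar i,
      ∃ H ∈ stopChildren μ T b A B Qstar G, F.toSet ⊆ H.toSet := by
  induction j, hij using Nat.le_induction generalizing F with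
  | base =>
    simp only [stopGen, Set.mem_iUnion] at hF
    obtain ⟨G, hG, hGF⟩ := hF
    exact ⟨G, hG, F, hGF, subset_rfl⟩
  | succ j _ ih =>
    rw [stopGen] at hF
    simp only [Set.mem_iUnion] at hF
    obtain ⟨R, hR, hRF⟩ := hF
    obtain ⟨G, hG, H, hH, hRH⟩ := ih hR
    exact ⟨G, hG, H, hH, hRF.2.1.trans hRH⟩

theorem exists_superset_of_mem_stopGen {i j : ℕ} (hij : i ≤ j) {F : Cube n}
    (hF : F ∈ stopGen μ T b A B Qstar j) :
    ∃ G ∈ stopGen μ T b A B Qstar i, F.toSet ⊆ G.toSet := by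
  rcases hij.eq_or_lt with rfl | hlt
  · exact ⟨F, hF, subset_rfl⟩
  · obtain ⟨G, hG, H, hH, hFH⟩ := exists_stopChildren_of_mem_stopGen hlt hF
    exact ⟨G, hG, hFH.trans hH.2.1⟩

/-- Stopping cubes of the same generation are disjoint. -/
theorem eq_of_mem_stopGen {j : ℕ} {F G : Cube n} (hF : F ∈ stopGen μ T b A B Qstar j)
    (hG : G ∈ stopGen μ T b A B Qstar j) {x : EuclideanSpace ℝ (Fin n)} (hxF : x ∈ F.toSet)
    (hxG : x ∈ G.toSet) : F = G := by
  induction j generalizing F G with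
  | zero => rw [show F = Qstar from hF, show G = Qstar from hG]
  | succ j ih =>
    simp only [stopGen, Set.mem_iUnion] at hF hG
    obtain ⟨F', hF', hFF'⟩ := hF
    obtain ⟨G', hG', hGG'⟩ := hG
    obtain rfl := ih hF' hG' (hFF'.2.1 hxF) (hGG'.2.1 hxG)
    rcases Cube.subset_or_subset hFF'.1 hGG'.1 hxF hxG with h | h
    · exact (hFF'.2.2.2 G hGG'.1 hGG'.2.1 hGG'.2.2.1 h).symm
    · exact hGG'.2.2.2 F hFF'.1 hFF'.2.1 hFF'.2.2.1 h

theorem exists_stopChildren_superset (hn : 1 ≤ n) {F Q : Cube n} (hQ : Q ∈ Qstar.dyadic)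
    (hQF : Q.toSet ⊆ F.toSet) (hQs : StopCondition μ T b A B F Q) :
    ∃ H ∈ stopChildren μ T b A B Qstar F, Q.toSet ⊆ H.toSet := by
  classical
  -- The maximal cube is found as the candidate of smallest generation.
  have hex : ∃ k, ∃ P ∈ Cube.dyadicGen Qstar k, Q.toSet ⊆ P.toSet ∧ P.toSet ⊆ F.toSet ∧
      StopCondition μ T b A B F P := by
    obtain ⟨k, hk⟩ := Cube.mem_dyadic_iff.1 hQ
    exact ⟨k, Q, hk, subset_rfl, hQF, hQs⟩
  obtain ⟨H, hH, hQH, hHF, hHs⟩ := Nat.find_spec hex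
  refine ⟨H, ⟨Cube.mem_dyadic_iff.2 ⟨_, hH⟩, hHF, hHs, fun P hP hPF hPs hHP => ?_⟩, hQH⟩
  obtain ⟨k, hk⟩ := Cube.mem_dyadic_iff.1 hP
  have hle := Nat.find_min' hex ⟨P, hk, hQH.trans hHP, hPF, hPs⟩
  exact Cube.toSet_injective hn
    ((Cube.subset_of_le hH hk hle H.corner_mem (hHP H.corner_mem)).antisymm hHP)

theorem exists_minimal_stopCube (hn : 1 ≤ n) {Q : Cube n} (hQ : Q ∈ Qstar.dyadic) :
    ∃ S ∈ stopCubes μ T b A B Qstar, Q.toSet ⊆ S.toSet ∧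
      ∀ S' ∈ stopCubes μ T b A B Qstar, Q.toSet ⊆ S'.toSet → S.toSet ⊆ S'.toSet := by
  classical
  obtain ⟨q, hq⟩ := Cube.mem_dyadic_iff.1 hQ
  set P : ℕ → Prop := fun s => ∃ S ∈ stopCubes μ T b A B Qstar, S ∈ Cube.dyadicGen Qstar s ∧
    Q.toSet ⊆ S.toSet with hP
  -- The deepest generation not below that of `Q` is taken; a stopping cube of later generation
  -- containing `Q` can only be `Q` itself.
  have h0 : P 0 := ⟨Qstar, mem_stopCubes_iff.2 ⟨0, rfl⟩, rfl, Cube.subset_of_mem_dyadic hQ⟩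
  obtain ⟨S, hS, hSs, hQS⟩ : P (Nat.findGreatest P q) := Nat.findGreatest_spec (Nat.zero_le q) h0
  refine ⟨S, hS, hQS, fun S' hS' hQS' => ?_⟩
  obtain ⟨s', hs'⟩ := Cube.mem_dyadic_iff.1 (mem_dyadic_of_mem_stopCubes hS')
  have hc := Q.corner_mem
  rcases le_or_gt s' q with h | h
  · exact Cube.subset_of_le hs' hSs (Nat.le_findGreatest h ⟨S', hS', hs', hQS'⟩) (hQS' hc) (hQS hc)
  · have hS'Q := Cube.toSet_injective hn
      (hQS'.antisymm (Cube.subset_of_le hq hs' h.le hc (hQS' hc)))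
    have hq' : q ≤ Nat.findGreatest P q :=
      Nat.le_findGreatest le_rfl ⟨Q, hS'Q ▸ hS', hq, subset_rfl⟩
    exact (Cube.subset_of_le hq hSs hq' hc (hQS hc)).trans hQS'

theorem stopParent_spec (hn : 1 ≤ n) {Q : Cube n} (hQ : Q ∈ Qstar.dyadic) :
    stopParent μ T b A B Qstar Q ∈ stopCubes μ T b A B Qstar ∧
      Q.toSet ⊆ (stopParent μ T b A B Qstar Q).toSet ∧
      ∀ S' ∈ stopCubes μ T b A B Qstar, Q.toSet ⊆ S'.toSet →
        (stopParent μ T b A B Qstar Q).toSet ⊆ S'.toSet := by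
  have h := exists_minimal_stopCube (μ := μ) (T := T) (b := b) (A := A) (B := B) hn hQ
  rw [stopParent, dif_pos h]
  exact h.choose_spec

theorem stopParent_eq_iff (hn : 1 ≤ n) {F Q : Cube n} (hF : F ∈ stopCubes μ T b A B Qstar)
    (hQ : Q ∈ Qstar.dyadic) : stopParent μ T b A B Qstar Q = F ↔ Q.toSet ⊆ F.toSet ∧
      ∀ S ∈ stopCubes μ T b A B Qstar, Q.toSet ⊆ S.toSet → F.toSet ⊆ S.toSet := by
  have hs := stopParent_spec (μ := μ) (T := T) (b := b) (A := A) (B := B) hn hQ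
  constructor
  · rintro rfl
    exact hs.2
  · rintro ⟨h1, h2⟩
    exact Cube.toSet_injective hn ((hs.2.2 F hF h1).antisymm (h2 _ hs.1 hs.2.1))

theorem stopParent_eq_of_subset (hn : 1 ≤ n) {F P Q : Cube n}
    (hF : F ∈ stopCubes μ T b A B Qstar) (hQ : Q ∈ Qstar.dyadic) (hP : P ∈ Qstar.dyadic)
    (hQP : Q.toSet ⊆ P.toSet) (hPF : P.toSet ⊆ F.toSet)
    (h : stopParent μ T b A B Qstar Q = F) : stopParent μ T b A B Qstar P = F := by
  rw [stopParent_eq_iff hn hF hP]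
  exact ⟨hPF, fun S hS hPS => ((stopParent_eq_iff hn hF hQ).1 h).2 S hS (hQP.trans hPS)⟩

theorem mem_stopGen_succ {j : ℕ} {F H : Cube n} (hF : F ∈ stopGen μ T b A B Qstar j)
    (hH : H ∈ stopChildren μ T b A B Qstar F) : H ∈ stopGen μ T b A B Qstar (j + 1) := by
  simp only [stopGen, Set.mem_iUnion]
  exact ⟨F, hF, hH⟩

/-- Otherwise `Q` would lie in a stopping child of `F`, which by minimality of `F` equals `F`. The
rule admits `F` as its own child, hence the assumption that `F` does not stop itself. -/
theorem not_stopCondition_of_stopParent_eq (hn : 1 ≤ n) {j : ℕ} {F Q : Cube n}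
    (hF : F ∈ stopGen μ T b A B Qstar j) (hFs : ¬ StopCondition μ T b A B F F)
    (hQ : Q ∈ Qstar.dyadic) (h : stopParent μ T b A B Qstar Q = F) :
    ¬ StopCondition μ T b A B F Q := by
  intro hs
  have h' := (stopParent_eq_iff hn (mem_stopCubes_iff.2 ⟨j, hF⟩) hQ).1 h
  obtain ⟨H, hH, hQH⟩ := exists_stopChildren_superset hn hQ h'.1 hs
  have h1 := h'.2 H (mem_stopCubes_iff.2 ⟨_, mem_stopGen_succ hF hH⟩) hQH
  rw [Cube.toSet_injective hn (h1.antisymm hH.2.1)] at hFs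
  obtain rfl := Cube.toSet_injective hn (h1.antisymm hH.2.1)
  exact hFs hH.2.2.1

/-- A child of a cube with stopping parent `F` either has stopping parent `F` or is a stopping cube
of the next generation. -/
theorem child_notMem_stopNext_iff (hn : 1 ≤ n) {j : ℕ} {F Q : Cube n}
    (hF : F ∈ stopGen μ T b A B Qstar j) (hFs : ¬ StopCondition μ T b A B F F)
    (hQ : Q ∈ Qstar.dyadic) (h : stopParent μ T b A B Qstar Q = F) (σ : Fin n → Fin 2) :
    Q.child σ ∉ stopNext μ T b A B Qstar j F ↔ stopParent μ T b A B Qstar (Q.child σ) = F := by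
  have hFc : F ∈ stopCubes μ T b A B Qstar := mem_stopCubes_iff.2 ⟨j, hF⟩
  obtain ⟨hQF, hmin⟩ := (stopParent_eq_iff hn hFc hQ).1 h
  have hQ' := Cube.child_mem_dyadic hQ σ
  have hsub := (Cube.child_subset Q σ).trans hQF
  have hc := (Q.child σ).corner_mem
  have hne : Q.child σ ≠ F := by
    intro he
    have h1 := Cube.toSet_injective hn
      ((Cube.child_subset Q σ).antisymm (by rw [he]; exact hQF))
    have h2 : Q.side / 2 = Q.side := congrArg Cube.side h1
    linarith [Q.side_pos]
  have hns : ¬ F.toSet ⊆ (Q.child σ).toSet := fun h1 =>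
    hne (Cube.toSet_injective hn (hsub.antisymm h1))
  rw [stopParent_eq_iff hn hFc hQ']
  constructor
  · intro hnext
    refine ⟨hsub, fun S hS hQS => ?_⟩
    by_cases hSQ : S = Q.child σ
    · exfalso
      subst hSQ
      obtain ⟨i, hi⟩ := mem_stopCubes_iff.1 hS
      -- A stopping child of generation at most `j` would contain `F`, which is too large. One of
      -- later generation lies in some `H` of generation `j + 1`; either `H` is the child itself, or
      -- `H` contains `Q` and must then be `F`.
      rcases le_or_gt i j with hij | hij
      · obtain ⟨G, hG, hFG⟩ := exists_superset_of_mem_stopGen hij hF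
        obtain rfl := eq_of_mem_stopGen hi hG hc (hFG (hsub hc))
        exact hns hFG
      · obtain ⟨G, hG, H, hH, hQH⟩ := exists_stopChildren_of_mem_stopGen hij hi
        obtain rfl := eq_of_mem_stopGen hG hF (hH.2.1 (hQH hc)) (hsub hc)
        have hHg := mem_stopGen_succ hG hH
        by_cases hHQ : H = Q.child σ
        · exact hnext ⟨hHQ ▸ hHg, hsub⟩
        · have h2 := Cube.subset_of_child_subset hn hQ hH.1 hQH hHQ
          have h3 := hmin H (mem_stopCubes_iff.2 ⟨_, hHg⟩) h2
          have h4 := Cube.toSet_injective hn (h3.antisymm hH.2.1)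
          rw [← h4] at hH
          exact hFs hH.2.2.1
    · exact hmin S hS
        (Cube.subset_of_child_subset hn hQ (mem_dyadic_of_mem_stopCubes hS) hQS hSQ)
  · rintro ⟨-, h1⟩ hnext
    exact hns (h1 _ (mem_stopCubes_iff.2 ⟨_, hnext.1⟩) subset_rfl)

end Stopping

/-! ### The dyadic partitions of a cube -/

section Cells

variable {n : ℕ}

/-- The cubes of generation `k` below `F` that contain `x`: a singleton if `x ∈ F`, and empty
otherwise. -/
def cellIndex (F : Cube n) (k : ℕ) (x : EuclideanSpace ℝ (Fin n)) : Set (Cube n) :=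
  {Q | Q ∈ Cube.dyadicGen F k ∧ x ∈ Q.toSet}

theorem cellIndex_eq_singleton {F Q : Cube n} {k : ℕ} (hQ : Q ∈ Cube.dyadicGen F k)
    {x : EuclideanSpace ℝ (Fin n)} (hx : x ∈ Q.toSet) : cellIndex F k x = {Q} := by
  ext P
  simp only [cellIndex, Set.mem_ofPred_eq, Set.mem_singleton_iff]
  constructor
  · rintro ⟨hP, hxP⟩
    exact Cube.eq_of_mem_dyadicGen hP hQ hxP hx
  · rintro rfl
    exact ⟨hQ, hx⟩

theorem cellIndex_preimage {F Q : Cube n} {k : ℕ} (hQ : Q ∈ Cube.dyadicGen F k)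
    {x : EuclideanSpace ℝ (Fin n)} (hx : x ∈ Q.toSet) :
    cellIndex F k ⁻¹' {cellIndex F k x} = Q.toSet := by
  ext y
  simp only [Set.mem_preimage, Set.mem_singleton_iff]
  rw [cellIndex_eq_singleton hQ hx]
  constructor
  · intro h
    have : Q ∈ cellIndex F k y := h ▸ rfl
    exact this.2
  · exact cellIndex_eq_singleton hQ

theorem isPartitionSeq_cellIndex (F : Cube n) : IsPartitionSeq (cellIndex F) where
  part k :=
    { finite := (Cube.finite_dyadicGen F k).finite_subsets.subset (by
        rintro _ ⟨x, rfl⟩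
        exact fun Q hQ => hQ.1)
      meas := fun i => by
        -- Points outside `F` all have index ∅ and form one cell, which is null for the measure
        -- restricted to `F`.
        by_cases hi : i ⊆ Cube.dyadicGen F k
        · have : cellIndex F k ⁻¹' {i}
              = ⋂ Q ∈ Cube.dyadicGen F k, {x | x ∈ Q.toSet ↔ Q ∈ i} := by
            ext x
            simp only [Set.mem_preimage, Set.mem_singleton_iff, Set.mem_iInter, Set.mem_ofPred_eq]
            constructor
            · rintro rfl Q hQ
              exact ⟨fun hx => ⟨hQ, hx⟩, fun hx => hx.2⟩
            · intro h
              ext Q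
              exact ⟨fun hQ => (h Q hQ.1).1 hQ.2, fun hQ => ⟨hi hQ, (h Q (hi hQ)).2 hQ⟩⟩
          rw [this]
          refine (Cube.finite_dyadicGen F k).measurableSet_biInter fun Q _ => ?_
          by_cases hQ : Q ∈ i
          · simp only [hQ, iff_true]
            exact Q.measurableSet_toSet
          · simp only [hQ, iff_false]
            exact Q.measurableSet_toSet.compl
        · have : cellIndex F k ⁻¹' {i} = ∅ := by
            refine Set.eq_empty_of_forall_notMem fun x hx => hi ?_
            rw [← show cellIndex F k x = i from hx]
            exact fun Q hQ => hQ.1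
          rw [this]
          exact MeasurableSet.empty }
  nested k x y h := by
    have key : ∀ x y, cellIndex F (k + 1) x = cellIndex F (k + 1) y →
        cellIndex F k x ⊆ cellIndex F k y := by
      rintro x y h Q ⟨hQ, hx⟩
      obtain ⟨σ, hσ⟩ := Cube.exists_mem_child hx
      have h1 : Q.child σ ∈ cellIndex F (k + 1) x := ⟨Cube.child_mem_dyadicGen hQ σ, hσ⟩
      rw [h] at h1
      exact ⟨hQ, Cube.child_subset Q σ h1.2⟩
    exact (key x y h).antisymm (key y x h.symm)

theorem cellAvg_cellIndex (μ : Measure (EuclideanSpace ℝ (Fin n))) {E : Type}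
    [NormedAddCommGroup E] [NormedSpace ℝ E] (f : EuclideanSpace ℝ (Fin n) → E) {F Q : Cube n}
    {k : ℕ} (hQ : Q ∈ Cube.dyadicGen F k) {x : EuclideanSpace ℝ (Fin n)} (hx : x ∈ Q.toSet) :
    cellAvg (μ.restrict F.toSet) (cellIndex F k) f x = ⨍ y in Q.toSet, f y ∂μ := by
  rw [cellAvg, cellIndex_preimage hQ hx, Measure.restrict_restrict Q.measurableSet_toSet,
    Set.inter_eq_left.2 (Cube.subset_of_mem_dyadicGen hQ)]

end Cells

/-! ### Test functions on cubes that satisfy no stopping condition -/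

section TestSystem

variable {n : ℕ} {μ : Measure (EuclideanSpace ℝ (Fin n))} {T : Lp ℂ 2 μ →L[ℂ] Lp ℂ 2 μ}
  {b : Cube n → Lp ℂ 2 μ} {A B : ℝ}

theorem Cube.measure_lt_top (hfin : ∀ x r, μ (Metric.ball x r) < ∞) (Q : Cube n) :
    μ Q.toSet < ∞ := by
  have hb : Bornology.IsBounded Q.toSet := by
    rw [Metric.isBounded_iff_subset_closedBall Q.corner]
    refine ⟨Real.sqrt (∑ _i : Fin n, Q.side ^ 2), fun x hx => ?_⟩
    rw [Metric.mem_closedBall, EuclideanSpace.dist_eq]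
    refine Real.sqrt_le_sqrt (Finset.sum_le_sum fun i _ => ?_)
    have := hx i
    rw [Real.dist_eq, sq_abs]
    exact pow_le_pow_left₀ (by linarith) (by linarith) 2
  obtain ⟨r, hr⟩ := hb.subset_ball Q.corner
  exact (measure_mono hr).trans_lt (hfin _ _)

theorem integral_normSq_eq (f : Lp ℂ 2 μ) : ∫ x, ‖f x‖ ^ 2 ∂μ = ‖f‖ ^ 2 := by
  have hm : AEStronglyMeasurable (fun x => ‖f x‖ ^ 2) μ := (Lp.aestronglyMeasurable f).norm.pow 2
  rw [Lp.norm_def, ← ENNReal.toReal_pow, eLpNorm_two_sq, integral_eq_lintegral_of_nonneg_ae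
    (Filter.Eventually.of_forall fun x => by positivity) hm]
  congr 1
  refine lintegral_congr fun x => ?_
  rw [ENNReal.ofReal_pow (norm_nonneg _), ofReal_norm]

theorem integrable_normSq (f : Lp ℂ 2 μ) : Integrable (fun x => ‖f x‖ ^ 2) μ :=
  (memLp_two_iff_integrable_sq_norm (Lp.aestronglyMeasurable f)).1 (Lp.memLp f)

/-- From mean one and 2|b| ≤ 1 + |b|², integrated over `F`, one gets 2 ≤ 1 + A. -/
theorem IsTestSystem.one_le (h : IsTestSystem μ T b A B) (F : Cube n) (hF : 0 < μ.real F.toSet) :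
    1 ≤ A := by
  have hfin : μ F.toSet ≠ ∞ := fun h => by simp [Measure.real, h] at hF
  have : IsFiniteMeasure (μ.restrict F.toSet) := ⟨by simpa using hfin.lt_top⟩
  have h2 : Integrable (fun x => ‖b F x‖ ^ 2) (μ.restrict F.toSet) :=
    (integrable_normSq (b F)).integrableOn
  have h1 : Integrable (b F) (μ.restrict F.toSet) :=
    ((Lp.memLp (b F)).restrict F.toSet).integrable one_le_two
  have e1 : μ.real F.toSet ≤ ∫ x in F.toSet, ‖b F x‖ ∂μ := by
    have := norm_integral_le_integral_norm (μ := μ.restrict F.toSet) (b F)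
    rw [h.integral_eq F] at this
    rw [Complex.norm_real] at this
    exact (le_abs_self _).trans this
  have e2 : ∫ x in F.toSet, ‖b F x‖ ∂μ ≤ ∫ x in F.toSet, (1 + ‖b F x‖ ^ 2) / 2 ∂μ := by
    refine integral_mono h1.norm (((integrable_const 1).add h2).div_const 2) fun x => ?_
    simp only
    nlinarith [sq_nonneg (‖b F x‖ - 1)]
  have e3 : ∫ x in F.toSet, (1 + ‖b F x‖ ^ 2) / 2 ∂μ
      = (μ.real F.toSet + ∫ x in F.toSet, ‖b F x‖ ^ 2 ∂μ) / 2 := by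
    rw [integral_div, integral_add (integrable_const 1) h2]
    simp
  have e4 : ∫ x in F.toSet, ‖b F x‖ ^ 2 ∂μ ≤ A * μ.real F.toSet :=
    (setIntegral_le_integral (integrable_normSq (b F))
      (Filter.Eventually.of_forall fun x => by positivity)).trans
      ((integral_normSq_eq (b F)).le.trans (h.norm_le F))
  by_contra! hA
  nlinarith

/-- The test conditions bound the three quantities on `F` by their thresholds, because A ≥ 1 gives A
≤ 16A² and B ≤ 16AB. Positive measure matters: on a null cube the mean of `b F` is read as 0, and
the first condition holds. -/
theorem IsTestSystem.not_stopCondition_self (h : IsTestSystem μ T b A B) {F : Cube n}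
    (hF : 0 < μ.real F.toSet) (hM : centredMaximalNorm μ ≠ ∞) :
    ¬ StopCondition μ T b A B F F := by
  have hfin : μ F.toSet ≠ ∞ := fun h => by simp [Measure.real, h] at hF
  have hF0 : μ F.toSet ≠ 0 := fun h => by simp [Measure.real, h] at hF
  have hA := h.one_le F hF
  have hB : 0 ≤ B := by
    have h1 : 0 ≤ ∫ x in F.toSet, ‖T (b F) x‖ ^ 2 ∂μ := integral_nonneg fun x => by positivity
    by_contra! hB
    nlinarith [h.testing F]
  rintro (h1 | h1 | h1)
  · rw [avg, setAverage_eq, h.integral_eq F, norm_smul] at h1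
    simp only [norm_inv, Real.norm_eq_abs, Complex.norm_real, abs_of_pos hF,
      inv_mul_cancel₀ hF.ne'] at h1
    norm_num at h1
  · have h2 := pow_le_pow_left' (eLpNorm_centredMaximal_le hM (Lp.memLp (b F))) 2
    rw [mul_pow, eLpNorm_two_sq] at h2
    simp only [enorm_eq_self] at h2
    have h3 : eLpNorm (b F) 2 μ ^ 2 ≤ ENNReal.ofReal A * μ F.toSet := by
      rw [← Lp.enorm_def, ← ofReal_norm, ← ENNReal.ofReal_pow (norm_nonneg _),
        ← ofReal_measureReal hfin, ← ENNReal.ofReal_mul (by linarith)]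
      exact ENNReal.ofReal_le_ofReal (h.norm_le F)
    rw [setLAverage_eq] at h1
    refine absurd h1 (not_lt.2 (ENNReal.div_le_of_le_mul ?_))
    calc ∫⁻ x in F.toSet, centredMaximal μ (b F) x ^ 2 ∂μ
        ≤ centredMaximalNorm μ ^ 2 * (ENNReal.ofReal A * μ F.toSet) :=
          (setLIntegral_le_lintegral _ _).trans (h2.trans (by gcongr))
      _ = ENNReal.ofReal A * centredMaximalNorm μ ^ 2 * μ F.toSet := by ring
      _ ≤ _ := by gcongr; nlinarith
  · rw [setAverage_eq, smul_eq_mul, ← div_eq_inv_mul, lt_div_iff₀ hF] at h1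
    have h2 := h.testing F
    have h3 : B * μ.real F.toSet ≤ 16 * A * B * μ.real F.toSet :=
      mul_le_mul_of_nonneg_right (by nlinarith) hF.le
    linarith

/-- From |b| ≤ 1 + |b|² ≤ 1 + (M_μ b)² almost everywhere, averaged over `Q`. -/
theorem setAverage_norm_le_of_not_stopCondition [IsLocallyFiniteMeasure μ]
    (hfin : ∀ x r, μ (Metric.ball x r) < ∞) {K : ℝ≥0} (hK : centredMaximalNorm μ ≤ K)
    {F Q : Cube n} (hb : Integrable (b F) μ) (h : ¬ StopCondition μ T b A B F Q) :
    ⨍ y in Q.toSet, ‖b F y‖ ∂μ ≤ 1 + 16 * A ^ 2 * K ^ 2 := by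
  have h2 : ⨍⁻ x in Q.toSet, centredMaximal μ (b F) x ^ 2 ∂μ ≤
      ENNReal.ofReal (16 * A ^ 2) * centredMaximalNorm μ ^ 2 :=
    not_lt.1 fun h' => h (Or.inr (Or.inl h'))
  have hQ := (Q.measure_lt_top hfin).ne
  have key : ∫⁻ y in Q.toSet, ‖b F y‖ₑ ∂μ
      ≤ ENNReal.ofReal ((1 + 16 * A ^ 2 * K ^ 2) * μ.real Q.toSet) := by
    calc ∫⁻ y in Q.toSet, ‖b F y‖ₑ ∂μ
        ≤ ∫⁻ y in Q.toSet, (1 + centredMaximal μ (b F) y ^ 2) ∂μ := by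
          refine lintegral_mono_ae (ae_restrict_of_ae ?_)
          filter_upwards [ae_enorm_le_centredMaximal hfin hb] with y hy
          rcases le_total ‖b F y‖ₑ 1 with h1 | h1
          · exact h1.trans le_self_add
          · calc ‖b F y‖ₑ ≤ ‖b F y‖ₑ ^ 2 := le_self_pow₀ h1 two_ne_zero
              _ ≤ centredMaximal μ (b F) y ^ 2 := by gcongr
              _ ≤ _ := le_add_self
      _ = μ Q.toSet + μ Q.toSet * ⨍⁻ x in Q.toSet, centredMaximal μ (b F) x ^ 2 ∂μ := by
          rw [lintegral_add_left measurable_const, setLIntegral_one, measure_mul_setLAverage _ hQ]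
      _ ≤ μ Q.toSet + μ Q.toSet * (ENNReal.ofReal (16 * A ^ 2) * (K : ℝ≥0∞) ^ 2) := by
          gcongr
          exact h2.trans (by gcongr)
      _ = _ := by
          rw [ENNReal.ofReal_mul (p := 1 + 16 * A ^ 2 * (K : ℝ) ^ 2) (by positivity),
            ENNReal.ofReal_add zero_le_one (by positivity),
            ENNReal.ofReal_mul (p := 16 * A ^ 2) (by positivity), ENNReal.ofReal_pow (NNReal.coe_nonneg K), ofReal_measureReal hQ,
            ENNReal.ofReal_coe_nnreal, ENNReal.ofReal_one]
          ring
  have h3 : ∫ y in Q.toSet, ‖b F y‖ ∂μ ≤ (1 + 16 * A ^ 2 * K ^ 2) * μ.real Q.toSet := by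
    rw [integral_norm_eq_lintegral_enorm hb.1.restrict]
    exact ENNReal.toReal_le_of_le_ofReal (by positivity) key
  rw [setAverage_eq, smul_eq_mul]
  rcases (measureReal_nonneg (μ := μ) (s := Q.toSet)).eq_or_lt with h0 | h0
  · rw [← h0, inv_zero, zero_mul]
    positivity
  · rwa [← div_eq_inv_mul, div_le_iff₀ h0]

end TestSystem

/-! ### The maximal truncation as a maximal partial sum -/

section Assembly

variable {n : ℕ} {μ : Measure (EuclideanSpace ℝ (Fin n))} {T : Lp ℂ 2 μ →L[ℂ] Lp ℂ 2 μ}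
  {b : Cube n → Lp ℂ 2 μ} {A B : ℝ} {Qstar : Cube n}

/-- The union of the cubes of generation `k` below `F` whose stopping parent is `F`. -/
def activeSet (μ : Measure (EuclideanSpace ℝ (Fin n))) (T : Lp ℂ 2 μ →L[ℂ] Lp ℂ 2 μ)
    (b : Cube n → Lp ℂ 2 μ) (A B : ℝ) (Qstar F : Cube n) (k : ℕ) :
    Set (EuclideanSpace ℝ (Fin n)) :=
  {x | ∃ Q ∈ cellIndex F k x, stopParent μ T b A B Qstar Q = F}

theorem mem_activeSet_iff {F Q : Cube n} {k : ℕ} (hQ : Q ∈ Cube.dyadicGen F k)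
    {x : EuclideanSpace ℝ (Fin n)} (hx : x ∈ Q.toSet) :
    x ∈ activeSet μ T b A B Qstar F k ↔ stopParent μ T b A B Qstar Q = F := by
  simp [activeSet, cellIndex_eq_singleton hQ hx]

open Classical in
/-- The coefficient `ε_Q` of the cube `Q` of generation `k` below `F` that contains `x`. -/
noncomputable def cellCoeff (ε : Cube n → ℂ) (F : Cube n) (k : ℕ)
    (x : EuclideanSpace ℝ (Fin n)) : ℂ :=
  if h : (cellIndex F k x).Nonempty then ε h.some else 0

open Classical in
theorem factorsThrough_cellCoeff (ε : Cube n → ℂ) (F : Cube n) (k : ℕ) :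
    (cellCoeff ε F k).FactorsThrough (cellIndex F k) := fun _ _ hxy =>
  congrArg (fun s : Set (Cube n) => if h : s.Nonempty then ε h.some else 0) hxy

theorem cellCoeff_eq (ε : Cube n → ℂ) {F Q : Cube n} {k : ℕ} (hQ : Q ∈ Cube.dyadicGen F k)
    {x : EuclideanSpace ℝ (Fin n)} (hx : x ∈ Q.toSet) : cellCoeff ε F k x = ε Q := by
  have h : (cellIndex F k x).Nonempty := ⟨Q, hQ, hx⟩
  rw [cellCoeff, dif_pos h]
  congr 1
  exact Cube.eq_of_mem_dyadicGen h.some_mem.1 hQ h.some_mem.2 hx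

theorem isAccretiveOn_activeSet [IsLocallyFiniteMeasure μ] (hn : 1 ≤ n)
    (hfin : ∀ x r, μ (Metric.ball x r) < ∞) {K : ℝ≥0} (hK : centredMaximalNorm μ ≤ K) {j : ℕ}
    {F : Cube n} (hF : F ∈ stopGen μ T b A B Qstar j) (hFs : ¬ StopCondition μ T b A B F F)
    (hb : Integrable (b F) μ) :
    IsAccretiveOn (μ.restrict F.toSet) (cellIndex F) (b F) (activeSet μ T b A B Qstar F)
      (1 + 16 * A ^ 2 * K ^ 2) := by
  have hFd := mem_dyadic_of_mem_stopGen hF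
  have hgen : ∀ {k : ℕ} {Q : Cube n}, Q ∈ Cube.dyadicGen F k → Q ∈ Qstar.dyadic := fun hQ =>
    Cube.mem_dyadic_of_mem hFd (Cube.mem_dyadic_iff.2 ⟨_, hQ⟩)
  refine ⟨fun k x y hxy => ?_, fun k x hx => ?_, fun k x hx => ?_, fun k x hx => ?_⟩
  · simp only [activeSet, Set.mem_ofPred_eq, hxy]
  · obtain ⟨Q, ⟨hQ, hxQ⟩, hQa⟩ := hx
    have hQ' := hQ
    simp only [Cube.dyadicGen, Set.mem_iUnion] at hQ
    obtain ⟨P, hP, σ, rfl⟩ := hQ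
    exact ⟨P, ⟨hP, Cube.child_subset P σ hxQ⟩, stopParent_eq_of_subset hn
      (mem_stopCubes_iff.2 ⟨j, hF⟩) (hgen hQ') (hgen hP) (Cube.child_subset P σ)
      (Cube.subset_of_mem_dyadicGen hP) hQa⟩
  · obtain ⟨Q, ⟨hQ, hxQ⟩, hQa⟩ := hx
    rw [cellAvg_cellIndex μ _ hQ hxQ]
    exact setAverage_norm_le_of_not_stopCondition hfin hK hb
      (not_stopCondition_of_stopParent_eq hn hF hFs (hgen hQ) hQa)
  · obtain ⟨Q, ⟨hQ, hxQ⟩, hQa⟩ := hx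
    rw [cellAvg_cellIndex μ _ hQ hxQ]
    exact not_lt.1 fun h' =>
      not_stopCondition_of_stopParent_eq hn hF hFs (hgen hQ) hQa (Or.inl h')

theorem halfTwisted_eq_zero {j : ℕ} {F Q : Cube n} {h : EuclideanSpace ℝ (Fin n) → ℂ}
    {x : EuclideanSpace ℝ (Fin n)} (hx : x ∉ Q.toSet) :
    halfTwisted μ T b A B Qstar j F h Q x = 0 := by
  rw [halfTwisted]
  exact Finset.sum_eq_zero fun σ _ =>
    Set.indicator_of_notMem (fun hσ => hx (Cube.child_subset Q σ hσ)) _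

theorem mul_halfTwisted_eq_quotIncrement (hn : 1 ≤ n) {j : ℕ} {F Q : Cube n}
    (hF : F ∈ stopGen μ T b A B Qstar j) (hFs : ¬ StopCondition μ T b A B F F) (ε : Cube n → ℂ)
    (h : EuclideanSpace ℝ (Fin n) → ℂ) {k : ℕ} (hQ : Q ∈ Cube.dyadicGen F k)
    (hQa : stopParent μ T b A B Qstar Q = F) {x : EuclideanSpace ℝ (Fin n)} (hx : x ∈ Q.toSet) :
    ε Q * halfTwisted μ T b A B Qstar j F h Q x =
      quotIncrement (μ.restrict F.toSet) (cellIndex F k) (cellIndex F (k + 1)) h (b F)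
        (cellCoeff ε F k) (activeSet μ T b A B Qstar F (k + 1)) x := by
  classical
  have hQd : Q ∈ Qstar.dyadic := Cube.mem_dyadic_of_mem (mem_dyadic_of_mem_stopGen hF)
    (Cube.mem_dyadic_iff.2 ⟨_, hQ⟩)
  obtain ⟨σ, hσ⟩ := Cube.exists_mem_child hx
  have hQσ := Cube.child_mem_dyadicGen hQ σ
  have hiff := child_notMem_stopNext_iff hn hF hFs hQd hQa σ
  rw [halfTwisted, Finset.sum_filter, Finset.sum_eq_single σ]
  · by_cases ha : stopParent μ T b A B Qstar (Q.child σ) = F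
    · rw [if_pos (hiff.2 ha), Set.indicator_of_mem hσ, ha, quotIncrement,
        Set.indicator_of_mem ((mem_activeSet_iff hQσ hσ).2 ha), cellCoeff_eq ε hQ hx, cellQuot,
        cellQuot, cellAvg_cellIndex μ _ hQσ hσ, cellAvg_cellIndex μ _ hQσ hσ,
        cellAvg_cellIndex μ _ hQ hx, cellAvg_cellIndex μ _ hQ hx]
      rfl
    · rw [if_neg fun h' => ha (hiff.1 h'), quotIncrement, Set.indicator_of_notMem fun h' =>
        ha ((mem_activeSet_iff hQσ hσ).1 h'), mul_zero]
  · intro τ _ hτ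
    rw [Set.indicator_of_notMem fun h' => hτ (Cube.eq_of_mem_child h' hσ), ite_self]
  · exact fun h' => absurd (Finset.mem_univ σ) h'

/-- The partial sum of generations `< K` that corresponds to the truncation of the half-twisted
martingale differences at scale `δ`. -/
theorem finsum_halfTwisted_eq_partialSum (hn : 1 ≤ n) {j : ℕ} {F : Cube n}
    (hF : F ∈ stopGen μ T b A B Qstar j) (hFs : ¬ StopCondition μ T b A B F F) (ε : Cube n → ℂ)
    (h : EuclideanSpace ℝ (Fin n) → ℂ) {x : EuclideanSpace ℝ (Fin n)} (hx : x ∈ F.toSet)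
    (hanti : ∀ k, activeSet μ T b A B Qstar F (k + 1) ⊆ activeSet μ T b A B Qstar F k)
    {δ : ℝ} {K : ℕ} (hK : ∀ k, k < K ↔ δ < F.side / 2 ^ k) :
    ∑ᶠ Q ∈ {Q | Q ∈ Qstar.dyadic ∧ stopParent μ T b A B Qstar Q = F ∧ δ < Q.side},
      ε Q * halfTwisted μ T b A B Qstar j F h Q x =
    partialSum (μ.restrict F.toSet) (cellIndex F) h (b F) (cellCoeff ε F)
      (activeSet μ T b A B Qstar F) K x := by
  classical
  have hFd := mem_dyadic_of_mem_stopGen hF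
  have hFc : F ∈ stopCubes μ T b A B Qstar := mem_stopCubes_iff.2 ⟨j, hF⟩
  choose q hq hxq using Cube.exists_mem_dyadicGen hx
  have hside : ∀ k, (q k).side = F.side / 2 ^ k := fun k => Cube.side_of_mem_dyadicGen F k _ (hq k)
  have hinj : Function.Injective q := by
    intro k l hkl
    have h1 : F.side / 2 ^ k = F.side / 2 ^ l := by rw [← hside, ← hside, hkl]
    have h2 : (2 : ℝ) ^ k = 2 ^ l := by
      have := F.side_pos.ne'
      field_simp at h1
      exact h1.symm
    exact Nat.pow_right_injective le_rfl (by exact_mod_cast h2)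
  -- At the point `x` only the cubes `q k` of the chain shrinking to `x` contribute.
  rw [finsum_mem_eq_sum_of_inter_support_eq (t := ((Finset.range K).filter fun k =>
    stopParent μ T b A B Qstar (q k) = F).image q)]
  · rw [Finset.sum_image hinj.injOn, Finset.sum_filter, partialSum]
    refine Finset.sum_congr rfl fun k _ => ?_
    split_ifs with ha
    · exact mul_halfTwisted_eq_quotIncrement hn hF hFs ε h (hq k) ha (hxq k)
    -- A cube with another stopping parent is missing from the sum on the left; the increment
    -- vanishes there because inactivity is inherited by smaller cubes.
    · rw [quotIncrement, Set.indicator_of_notMem fun h' =>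
        ha ((mem_activeSet_iff (hq k) (hxq k)).1 (hanti k h'))]
  · ext Q
    simp only [Set.mem_inter_iff, Function.mem_support, Set.mem_ofPred_eq, Finset.coe_image,
      Finset.coe_filter, Finset.mem_range, Set.mem_image]
    refine and_congr_left fun hne => ?_
    constructor
    · rintro ⟨hQ, hQa, hQδ⟩
      have hxQ : x ∈ Q.toSet := by
        by_contra hxQ
        exact hne (by rw [halfTwisted_eq_zero hxQ, mul_zero])
      obtain ⟨k, hk⟩ := Cube.mem_dyadic_iff.1
        (Cube.mem_dyadic_of_subset hn hFd hQ ((stopParent_eq_iff hn hFc hQ).1 hQa).1)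
      have hQk := Cube.eq_of_mem_dyadicGen (hq k) hk (hxq k) hxQ
      refine ⟨k, ⟨(hK k).2 ?_, hQk ▸ hQa⟩, hQk⟩
      rw [← hside, hQk]
      exact hQδ
    · rintro ⟨k, ⟨hkK, hka⟩, rfl⟩
      exact ⟨Cube.mem_dyadic_of_mem hFd (Cube.mem_dyadic_iff.2 ⟨k, hq k⟩), hka,
        by rw [hside]; exact (hK k).1 hkK⟩

theorem maximalTruncation_le (hn : 1 ≤ n) {j : ℕ} {F : Cube n}
    (hF : F ∈ stopGen μ T b A B Qstar j) (hFs : ¬ StopCondition μ T b A B F F) (ε : Cube n → ℂ)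
    (h : EuclideanSpace ℝ (Fin n) → ℂ) {x : EuclideanSpace ℝ (Fin n)} (hx : x ∈ F.toSet)
    (hanti : ∀ k, activeSet μ T b A B Qstar F (k + 1) ⊆ activeSet μ T b A B Qstar F k) :
    maximalTruncation μ T b A B Qstar j F ε h x ≤ ⨆ N : ℕ, ENNReal.ofReal (runningMax
      (fun k x => ‖partialSum (μ.restrict F.toSet) (cellIndex F) h (b F) (cellCoeff ε F)
        (activeSet μ T b A B Qstar F) k x‖) N x) := by
  classical
  refine iSup₂_le fun δ hδ => ?_
  have hex : ∃ k : ℕ, F.side / 2 ^ k ≤ δ := by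
    obtain ⟨k, hk⟩ := pow_unbounded_of_one_lt (F.side / δ) (one_lt_two (α := ℝ))
    refine ⟨k, ?_⟩
    rw [div_lt_iff₀ hδ] at hk
    rw [div_le_iff₀ (by positivity)]
    linarith
  -- Sides decrease with the generation, so truncating at `δ` keeps precisely an initial segment of
  -- generations.
  have hK : ∀ k, k < Nat.find hex ↔ δ < F.side / 2 ^ k := by
    intro k
    rw [Nat.lt_find_iff]
    constructor
    · exact fun h' => not_le.1 (h' k le_rfl)
    · intro h' i hi
      refine not_le.2 (h'.trans_le ?_)
      have := F.side_pos.le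
      gcongr
      exact one_le_two
  rw [finsum_halfTwisted_eq_partialSum hn hF hFs ε h hx hanti hK, ← ofReal_norm]
  exact le_iSup_of_le (Nat.find hex) (ENNReal.ofReal_le_ofReal
    (le_runningMax (fun k x => ‖partialSum (μ.restrict F.toSet) (cellIndex F) h (b F)
      (cellCoeff ε F) (activeSet μ T b A B Qstar F) k x‖) le_rfl x))

theorem maximalTruncation_eq_zero (hn : 1 ≤ n) {F : Cube n} {j : ℕ}
    (hF : F ∈ stopGen μ T b A B Qstar j) (ε : Cube n → ℂ) (h : EuclideanSpace ℝ (Fin n) → ℂ)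
    {x : EuclideanSpace ℝ (Fin n)} (hx : x ∉ F.toSet) :
    maximalTruncation μ T b A B Qstar j F ε h x = 0 := by
  simp only [maximalTruncation, ENNReal.iSup_eq_zero]
  intro δ _
  rw [finsum_mem_eq_zero_of_forall_eq_zero, enorm_zero]
  rintro Q ⟨hQ, hQa, -⟩
  have hQF := ((stopParent_eq_iff hn (mem_stopCubes_iff.2 ⟨j, hF⟩) hQ).1 hQa).1
  rw [halfTwisted_eq_zero fun h' => hx (hQF h'), mul_zero]

theorem eLpNorm_ofReal_rpow {X E : Type} [MeasurableSpace X] [TopologicalSpace E]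
    [ContinuousENorm E] (μ : Measure X) (f : X → E) {p : ℝ} (hp : 0 < p) :
    eLpNorm f (ENNReal.ofReal p) μ ^ p = ∫⁻ x, ‖f x‖ₑ ^ p ∂μ := by
  rw [eLpNorm_eq_lintegral_rpow_enorm_toReal (by simpa using hp) ENNReal.ofReal_ne_top,
    ENNReal.toReal_ofReal hp.le, ← ENNReal.rpow_mul, one_div, inv_mul_cancel₀ hp.ne',
    ENNReal.rpow_one]

end Assembly

end LocalTb

/-! ### Proof of the proposition -/

theorem proposition2p12 (n : ℕ) (hn : 1 ≤ n) (p : ℝ) (hp : 1 < p) (A : ℝ) :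
    ∃ C : ℝ≥0, ∀ (μ : Measure (EuclideanSpace ℝ (Fin n))) (m : ℝ), 0 < m →
      LocalTb.HasGrowth μ m →
      ∀ T : Lp ℂ 2 μ →L[ℂ] Lp ℂ 2 μ, LocalTb.IsCalderonZygmund μ m T →
      ∀ (b : LocalTb.Cube n → Lp ℂ 2 μ) (B : ℝ), LocalTb.IsTestSystem μ T b A B →
      ∀ (Qstar : LocalTb.Cube n) (j : ℕ), ∀ F ∈ LocalTb.stopGen μ T b A B Qstar j,
      ∀ ε : LocalTb.Cube n → ℂ, (∀ Q ∈ Qstar.dyadic, ‖ε Q‖ ≤ 1) →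
      ∀ h : EuclideanSpace ℝ (Fin n) → ℂ, MemLp h (ENNReal.ofReal p) μ →
        eLpNorm (LocalTb.maximalTruncation μ T b A B Qstar j F ε h) (ENNReal.ofReal p) μ ^ p ≤
          C * eLpNorm h (ENNReal.ofReal p) μ ^ p := by
  obtain ⟨K, hK⟩ := LocalTb.exists_centredMaximalNorm_le n
  obtain ⟨C, hC⟩ := LocalTb.lintegral_runningMax_partialSum_rpow_le p (1 + 16 * A ^ 2 * K ^ 2) hp
    (le_add_of_nonneg_right (by positivity))
  refine ⟨C, fun μ m _ hgrowth T _ b B htest Qstar j F hF ε hε h hh => ?_⟩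
  have hp0 : 0 < p := zero_lt_one.trans hp
  have hfin := hgrowth.measure_ball_lt_top
  have := hgrowth.isLocallyFiniteMeasure
  have hM := hK μ hfin
  have hFm := F.measurableSet_toSet
  have hFfin := F.measure_lt_top hfin
  rw [LocalTb.eLpNorm_ofReal_rpow μ _ hp0, LocalTb.eLpNorm_ofReal_rpow μ _ hp0]
  simp only [enorm_eq_self]
  have hout : ∀ x ∉ F.toSet, LocalTb.maximalTruncation μ T b A B Qstar j F ε h x ^ p = 0 :=
    fun x hx => by rw [LocalTb.maximalTruncation_eq_zero hn hF ε h hx, ENNReal.zero_rpow_of_pos hp0]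
  rw [← setLIntegral_eq_of_support_subset fun x hx => by_contra fun hx' => hx (hout x hx')]
  -- If `F` is null it may stop itself and the stopping structure degenerates, but the truncation
  -- lives on `F` and the left side is zero.
  rcases eq_or_ne (μ F.toSet) 0 with hF0 | hF0
  · rw [setLIntegral_measure_zero _ _ hF0]
    exact bot_le
  have : IsFiniteMeasure (μ.restrict F.toSet) := ⟨by simpa using hFfin⟩
  have hFpos : 0 < μ.real F.toSet := ENNReal.toReal_pos hF0 hFfin.ne
  have hFs := htest.not_stopCondition_self hFpos (hM.trans_lt ENNReal.coe_lt_top).ne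
  have hbF : Integrable (b F) (μ.restrict F.toSet) :=
    ((Lp.memLp (b F)).restrict F.toSet).integrable one_le_two
  -- Integrability on the whole space, needed for the differentiation theorem, follows from the
  -- support condition.
  have hb : Integrable (b F) μ :=
    IntegrableOn.integrable_of_ae_notMem_eq_zero hbF (htest.supp F)
  have hhF : Integrable h (μ.restrict F.toSet) :=
    (hh.restrict F.toSet).integrable (ENNReal.one_le_ofReal.2 hp.le)
  have hα := LocalTb.isAccretiveOn_activeSet hn hfin hM hF hFs hb
  have hc := LocalTb.isPartitionSeq_cellIndex F
  have hε' := LocalTb.factorsThrough_cellCoeff ε F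
  have hε1 : ∀ k x, ‖LocalTb.cellCoeff ε F k x‖ ≤ 1 := fun k x => by
    rw [LocalTb.cellCoeff]
    split_ifs with hne
    · exact hε _ (LocalTb.Cube.mem_dyadic_of_mem (LocalTb.mem_dyadic_of_mem_stopGen hF)
        (LocalTb.Cube.mem_dyadic_iff.2 ⟨k, hne.some_mem.1⟩))
    · simp
  set S : ℕ → EuclideanSpace ℝ (Fin n) → ℝ := fun k x => ‖LocalTb.partialSum (μ.restrict F.toSet)
    (LocalTb.cellIndex F) h (b F) (LocalTb.cellCoeff ε F) (LocalTb.activeSet μ T b A B Qstar F)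
    k x‖ with hS
  have hSl := hc.factorsThrough_partialSum (μ.restrict F.toSet) h (b F) hε' hα.level
  have hmax : ∀ N, Measurable (LocalTb.runningMax S N) := fun N =>
    (hc.part N).measurable (hc.factorsThrough_runningMax
      (fun k x y hxy => by simp only [hS, hSl k hxy]) N)
  have hmax0 := LocalTb.runningMax_nonneg (g := S) fun _ _ => norm_nonneg _
  have hmono : ∀ x, Monotone fun N => LocalTb.runningMax S N x := fun x N N' hNN =>
    LocalTb.runningMax_le_iff.2 fun k hk => LocalTb.le_runningMax S (hk.trans hNN) x
  calc ∫⁻ x in F.toSet, LocalTb.maximalTruncation μ T b A B Qstar j F ε h x ^ p ∂μ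
      ≤ ∫⁻ x in F.toSet, ⨆ N, ENNReal.ofReal (LocalTb.runningMax S N x ^ p) ∂μ := by
        refine setLIntegral_mono' hFm fun x hx => ?_
        refine (ENNReal.rpow_le_rpow
          (LocalTb.maximalTruncation_le hn hF hFs ε h hx hα.anti) hp0.le).trans ?_
        refine ((ENNReal.orderIsoRpow p hp0).map_iSup _).trans_le ?_
        exact iSup_mono fun N => (ENNReal.ofReal_rpow_of_nonneg (hmax0 N x) hp0.le).le
    _ = ⨆ N, ∫⁻ x in F.toSet, ENNReal.ofReal (LocalTb.runningMax S N x ^ p) ∂μ :=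
        lintegral_iSup (fun N => ((hmax N).pow_const p).ennreal_ofReal) fun N N' hNN x =>
          ENNReal.ofReal_le_ofReal (Real.rpow_le_rpow (hmax0 N x) (hmono x hNN) hp0.le)
    _ ≤ C * ∫⁻ x in F.toSet, ENNReal.ofReal (‖h x‖ ^ p) ∂μ :=
        iSup_le fun N => hC _ _ _ _ hc h (b F) hhF hbF _ hα _ hε' hε1 N
    _ ≤ C * ∫⁻ x, ‖h x‖ₑ ^ p ∂μ := by
        gcongr C * ?_
        refine (setLIntegral_le_lintegral _ _).trans_eq (lintegral_congr fun x => ?_)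
        rw [← ENNReal.ofReal_rpow_of_nonneg (norm_nonneg _) hp0.le, ofReal_norm]
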